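/- \textbf{Calculus.} Processes of CCS$_\sigma$ are $P ::= L{:}\alpha.P \mid P|Q \mid P+Q \mid L{:}\sum_i p_iP_i \mid (\nu a)P \mid {!P} \mid 0$, with prefixes $\alpha::=a\mid\bar a\mid\tau$ and labels $L=l^{I}$, where $l$ is an atomic label and $I$ a finite binary string ($l$ stands for $l^\epsilon$). Schedulers, of finite or infinite length, are $S ::= \sigma(L).S \mid \sigma(L_1,L_2).S \mid 0 \mid \sum_i S_i$. The complete process $P\parallel S$ is a probabilistic automaton whose transitions are as follows. The scheduler $\sigma(L).S$ lets one occurrence of a prefix $L{:}\alpha.P$ or of a probabilistic sum $L{:}\sum_i p_iP_i$ act: the former performs $\alpha$ and becomes $P$, the latter performs $\tau$ and becomes $P_i$ with probability $p_i$. The scheduler $\sigma(L_1,L_2).S$ lets the $L_1$-labelled prefix in the left component and the $L_2$-labelled prefix in the right component of a parallel composition synchronize on complementary actions, giving a $\tau$. Both continue with $S$. The rules for $|$, $+$, $(\nu a)$, $!$ are those of CCS, where each copy made by replication is relabelled by extending the indices ($!P$ spawns a copy with $0$ appended and continues with $1$ appended; if two copies synchronize, $0$, $10$ and $11$ are appended).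 A scheduler sum $\sum_i S_i$ in a complete process behaves as the first $S_i$ for which the complete process has a transition. Secret value passing of bits is the abbreviation $l{:}c(x).P := l{:}c0.P[0/x] + l{:}c1.P[1/x]$ and $l{:}\bar c\langle v\rangle.P := l{:}\overline{cv}.P$; $(\nu c)P$ means $(\nu c0)(\nu c1)P$. \textbf{Protocol.} Let $p_0,p_1,p_2\ge 0$ with $p_0+p_1+p_2=1$. Indices are modulo $3$, $\otimes$ is addition modulo $2$, and $[i=k]$ is $1$ if $i=k$ and $0$ otherwise. Let $$\begin{aligned} B_i &= l_2{:}\bar m_0\langle [i=0]\rangle \mid l_3{:}\bar m_1\langle [i=1]\rangle \mid l_4{:}\bar m_2\langle [i=2]\rangle,\qquad Master = l_1{:}\textstyle\sum_{i=0}^{2} p_i\, B_i,\\ Crypt_i &= l_{5,i}{:}m_i(pay).\ l_{6,i}{:}c_{i,i}(coin_1).\ l_{7,i}{:}c_{i,i+1}(coin_2).\ l_{8,i}{:}\overline{out}_i\langle pay\otimes coin_1\otimes coin_2\rangle,\\ Coin_i &= l_{9,i}{:}\big((l_{10,i}{:}\bar c_{i,i}\langle 0\rangle \mid l_{11,i}{:}\bar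 c_{i-1,i}\langle 0\rangle) +_{0.5} (l_{10,i}{:}\bar c_{i,i}\langle 1\rangle \mid l_{11,i}{:}\bar c_{i-1,i}\langle 1\rangle)\big),\\ Prot &= (\nu \vec m)\big(Master \mid (\nu\vec c)(\textstyle\prod_{i=0}^2 Crypt_i \mid \prod_{i=0}^2 Coin_i)\big), \end{aligned}$$ where all displayed labels and all displayed channels are distinct. \textbf{Proposition (strong probabilistic anonymity).} Let $S$ be any scheduler. Then from each reachable state of $Prot\parallel S$ at most one transition is available, and the cone probabilities of the finite complete executions of $Prot\parallel S$ sum to $1$, so that they define a probability $p_S$ on its complete executions. Let $\bar m_i\langle 1\rangle$ be the event that the master has selected cryptographer $i$ as the payer (his probabilistic choice has been executed and its outcome is $B_i$). For every finite sequence $\vec o$ of announcements $\overline{out}_k\langle b\rangle$ let $\vec o$ also denote the event that the sequence of visible actions of the execution is $\vec o$. Then, for all $\vec o$ and all $i,j\in\{0,1,2\}$ for which $\bar m_i\langle 1\rangle$ and $\bar m_j\langle 1\rangle$ have positive probability, $$p_S(\vec o\mid \bar m_i\langle 1\rangle)=p_S(\vec o\mid \bar m_j\langle 1\rangle).$$ 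-/

import Mathlib

open scoped ENNReal

/-! ## Simple probabilistic automata -/

universe u v

/-- A simple probabilistic automaton with states `Q` and actions `A`. Discrete probability
measures over the states are `PMF Q`; `trans s a μ` says that `(s, a, μ)` is a transition. -/
structure ProbAut (Q : Type u) (A : Type v) where
  init : Q
  trans : Q → A → PMF Q → Prop

/-- A finite sequence `a₁ s₁ a₂ s₂ … aₙ sₙ` of actions and states; together with an initial state
`s₀` this is a finite execution `s₀ a₁ s₁ … aₙ sₙ`. -/
def Exec (Q : Type u) (A : Type v) : Type (max u v) := List (A × Q)

instance instMeasurableSpaceExec (Q : Type u) (A : Type v) : MeasurableSpace (Exec Q A) := ⊤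

namespace ProbAut

variable {Q : Type u} {A : Type v}

/-- States that occur in some execution of the automaton. -/
inductive Reachable (M : ProbAut Q A) : Q → Prop
  | init : Reachable M M.init
  | step {s t : Q} {a : A} {μ : PMF Q} :
      Reachable M s → M.trans s a μ → μ t ≠ 0 → Reachable M t

/-- From each (reachable) state at most one transition is available. -/
def FullyProbabilistic (M : ProbAut Q A) : Prop :=
  ∀ s, M.Reachable s → ∀ a b μ ν, M.trans s a μ → M.trans s b ν → a = b ∧ μ = ν

/-- No transition is available from `s`. -/
def Deadlocked (M : ProbAut Q A) (s : Q) : Prop := ∀ a μ, ¬ M.trans s a μ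

/-- The probability to move from `s` to `t` with action `a`. In a fully probabilistic automaton the
sum has at most one term, namely `μ t` for the only transition `(s, a, μ)` from `s`. -/
noncomputable def stepProb (M : ProbAut Q A) (s : Q) (a : A) (t : Q) : ℝ≥0∞ :=
  ∑' μ : {μ : PMF Q // M.trans s a μ}, μ.1 t

/-- The probability of the cone of the finite execution that starts in `s` and continues with
the given actions and states: the product of the probabilities of its steps. -/
noncomputable def coneProb (M : ProbAut Q A) : Q → List (A × Q) → ℝ≥0∞
  | _, [] => 1
  | s, (a, t) :: r => M.stepProb s a t * coneProb M t r

/-- The last state of the execution that starts in `s`. -/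
def lastState : Q → List (A × Q) → Q
  | s, [] => s
  | _, (_, t) :: r => lastState t r

/-- The finite execution from the initial state is complete (cannot be extended). -/
def Complete (M : ProbAut Q A) (e : Exec Q A) : Prop := M.Deadlocked (lastState M.init e)

/-- The measure that a fully probabilistic automaton induces on its finite complete executions:
each of them has the probability of its cone. It is a probability measure as soon as the automaton
terminates with probability one. -/
noncomputable def execMeasure (M : ProbAut Q A) : MeasureTheory.Measure (Exec Q A) :=
  MeasureTheory.Measure.sum fun e : {e : Exec Q A // M.Complete e} =>
    M.coneProb M.init e.1 • MeasureTheory.Measure.dirac e.1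

end ProbAut

/-! ## The calculus CCS with explicit schedulers -/

namespace CCSSigma

/-- Actions over the channel names `C`: input `a`, output `ā`, and the silent action. -/
inductive Act (C : Type) : Type
  | inp (a : C)
  | out (a : C)
  | tau

/-- Complementary action. -/
def Act.co {C : Type} : Act C → Act C
  | .inp a => .out a
  | .out a => .inp a
  | .tau => .tau

/-- All actions except the silent one are visible. -/
def Act.isVisible {C : Type} : Act C → Bool
  | .tau => false
  | _ => true

/-- A label `l^I`: an atomic label `l` with a finite binary string `I` as index. -/
structure Label (L : Type) : Type where
  atom : L
  index : List Bool

/-- Processes over channel names `C` and atomic labels `L`. -/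
inductive Proc (C L : Type) : Type
  | act (l : Label L) (α : Act C) (P : Proc C L)
  | par (P Q : Proc C L)
  | choice (P Q : Proc C L)
  | prob (l : Label L) (n : ℕ) (p : PMF (Fin n)) (P : Fin n → Proc C L)
  | res (a : C) (P : Proc C L)
  | bang (P : Proc C L)
  | nil

/-- The relabelling `ρ_k`, which replaces each label `l^s` by `l^(sk)`. -/
def Proc.relabel {C L : Type} (k : List Bool) : Proc C L → Proc C L
  | .act l α P => .act ⟨l.atom, l.index ++ k⟩ α (P.relabel k)
  | .par P Q => .par (P.relabel k) (Q.relabel k)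
  | .choice P Q => .choice (P.relabel k) (Q.relabel k)
  | .prob l n p P => .prob ⟨l.atom, l.index ++ k⟩ n p fun i => (P i).relabel k
  | .res a P => .res a (P.relabel k)
  | .bang P => .bang (P.relabel k)
  | .nil => .nil

/-- The two commands of a scheduler: `σ(l)` and `σ(l₁, l₂)`. -/
inductive Cmd (L : Type) : Type
  | single (l : Label L)
  | sync (l₁ l₂ : Label L)

/-- `Step P κ α μ` is the transition `P ‖ κ.S —α→ μ ‖ S`: the process `P`, scheduled by the command
`κ`, performs `α` and moves to the distribution `μ`. The continuation `S` of the scheduler is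
handed on unchanged by every rule and therefore not mentioned. -/
inductive Step {C L : Type} : Proc C L → Cmd L → Act C → PMF (Proc C L) → Prop
  | act (l : Label L) (α : Act C) (P : Proc C L) :
      Step (.act l α P) (.single l) α (PMF.pure P)
  | res {P : Proc C L} {κ : Cmd L} {α : Act C} {μ : PMF (Proc C L)} (a : C) :
      Step P κ α μ → α ≠ .inp a → α ≠ .out a → Step (.res a P) κ α (μ.map (Proc.res a))
  | sum1 {P : Proc C L} {κ : Cmd L} {α : Act C} {μ : PMF (Proc C L)} (Q : Proc C L) :
      Step P κ α μ → Step (.choice P Q) κ α μ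
  | sum2 {Q : Proc C L} {κ : Cmd L} {α : Act C} {μ : PMF (Proc C L)} (P : Proc C L) :
      Step Q κ α μ → Step (.choice P Q) κ α μ
  | par1 {P : Proc C L} {κ : Cmd L} {α : Act C} {μ : PMF (Proc C L)} (Q : Proc C L) :
      Step P κ α μ → Step (.par P Q) κ α (μ.map fun P' => .par P' Q)
  | par2 {Q : Proc C L} {κ : Cmd L} {α : Act C} {μ : PMF (Proc C L)} (P : Proc C L) :
      Step Q κ α μ → Step (.par P Q) κ α (μ.map fun Q' => .par P Q')
  | com {P Q P' Q' : Proc C L} {l₁ l₂ : Label L} {α : Act C} : α ≠ .tau →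
      Step P (.single l₁) α (PMF.pure P') → Step Q (.single l₂) α.co (PMF.pure Q') →
      Step (.par P Q) (.sync l₁ l₂) .tau (PMF.pure (.par P' Q'))
  | prob (l : Label L) (n : ℕ) (p : PMF (Fin n)) (P : Fin n → Proc C L) :
      Step (.prob l n p P) (.single l) .tau (p.map P)
  | bang1 {P : Proc C L} {κ : Cmd L} {α : Act C} {μ : PMF (Proc C L)} :
      Step P κ α μ →
      Step (.bang P) κ α
        (μ.map fun P' => .par (P'.relabel [false]) ((Proc.bang P).relabel [true]))
  | bang2 {P P₁ P₂ : Proc C L} {l₁ l₂ : Label L} {α : Act C} : α ≠ .tau →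
      Step P (.single l₁) α (PMF.pure P₁) → Step P (.single l₂) α.co (PMF.pure P₂) →
      Step (.bang P) (.sync l₁ l₂) .tau
        (PMF.pure (.par (.par (P₁.relabel [false]) (P₂.relabel [true, false]))
          ((Proc.bang P).relabel [true, true])))

/-- Scheduler terms `0`, `κ.x` and `∑ᵢ Sᵢ`, where the continuations `x` of the commands are taken
from `X`. Sums are indexed by the natural numbers; a finite sum is one that continues with `0`,
which never schedules anything. -/
inductive SchedTerm (L : Type) (X : Type u) : Type u
  | nil
  | cmd (κ : Cmd L) (x : X)
  | sum (S : ℕ → SchedTerm L X)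

/-- A scheduler, of finite or infinite length. It is given by the set `X` of its subterms after a
command (and itself), where the subterm `x` unfolds to `eqn x`; conversely each such guarded system
of equations unfolds to a possibly infinite scheduler. -/
structure Scheduler (L : Type) where
  X : Type u
  eqn : X → SchedTerm L X
  start : X

/-- Transitions of the complete process `P ‖ S` for a scheduler term `S`. In a sum the first summand
that can schedule a transition of `P` is taken. -/
def SchedTerm.trans {C L : Type} {X : Type u} (P : Proc C L) :
    SchedTerm L X → Act C → PMF (Proc C L × X) → Prop
  | .nil, _, _ => False
  | .cmd κ x, α, μ => ∃ ν, Step P κ α ν ∧ μ = ν.map fun P' => (P', x)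
  | .sum S, α, μ => ∃ i, (S i).trans P α μ ∧ ∀ j < i, ¬ ∃ β ν, (S j).trans P β ν

/-- The probabilistic automaton of the complete process `P ‖ S`. -/
def completeProcess {C L : Type} (P : Proc C L) (S : Scheduler.{u} L) :
    ProbAut (Proc C L × S.X) (Act C) where
  init := (P, S.start)
  trans s α μ := (S.eqn s.2).trans s.1 α μ

/-- `(ν a₁) … (ν aₙ) P`. -/
def Proc.resAll {C L : Type} (as : List C) (P : Proc C L) : Proc C L := as.foldr Proc.res P

/-- Secret input of a bit: `l : c(x).P` is `l : c0.P[0/x] + l : c1.P[1/x]`, where the channels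
`c0`, `c1` are `c false`, `c true`. -/
def Proc.recvBit {C L : Type} (l : L) (c : Bool → C) (P : Bool → Proc C L) : Proc C L :=
  .choice (.act ⟨l, []⟩ (.inp (c false)) (P false)) (.act ⟨l, []⟩ (.inp (c true)) (P true))

/-- Secret output of a bit, followed by nil. -/
def Proc.sendBit {C L : Type} (l : L) (c : Bool → C) (b : Bool) : Proc C L :=
  .act ⟨l, []⟩ (.out (c b)) .nil

/-- Parallel composition `P₀ | P₁ | P₂`. -/
def Proc.par3 {C L : Type} (P : Fin 3 → Proc C L) : Proc C L := .par (.par (P 0) (P 1)) (P 2)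

end CCSSigma

/-! ## The dining cryptographers with probabilistic master -/

namespace DiningCryptographers

open CCSSigma

/-- Channel names, one for each bit that may be transmitted: `m i` from the master to
cryptographer `i`, `c i j` from coin `j` to cryptographer `i`, and `out i` for the announcement of
cryptographer `i`. -/
inductive Chan : Type
  | m (i : Fin 3) (b : Bool)
  | c (i j : Fin 3) (b : Bool)
  | out (i : Fin 3) (b : Bool)

/-- Atomic labels; `lm i` stands for the labels `l₂, l₃, l₄` of the outputs of the master to the
cryptographers `i = 0, 1, 2`. -/
inductive Lab : Type
  | l1
  | lm (i : Fin 3)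
  | l5 (i : Fin 3)
  | l6 (i : Fin 3)
  | l7 (i : Fin 3)
  | l8 (i : Fin 3)
  | l9 (i : Fin 3)
  | l10 (i : Fin 3)
  | l11 (i : Fin 3)

/-- What the master becomes after he has selected cryptographer `i` as the payer: he sends the bit
`i == k` to each cryptographer `k`. -/
def masterBranch (i : Fin 3) : Proc Chan Lab :=
  .par3 fun k => .sendBit (.lm k) (.m k) (i == k)

/-- The master selects cryptographer `i` with probability `p i`. -/
noncomputable def master (p : PMF (Fin 3)) : Proc Chan Lab :=
  .prob ⟨.l1, []⟩ 3 p masterBranch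

/-- Cryptographer `i`. The sum of indices is modulo 3. -/
def crypt (i : Fin 3) : Proc Chan Lab :=
  .recvBit (.l5 i) (.m i) fun pay =>
  .recvBit (.l6 i) (.c i i) fun coin₁ =>
  .recvBit (.l7 i) (.c i (i + 1)) fun coin₂ =>
  .sendBit (.l8 i) (.out i) (xor pay (xor coin₁ coin₂))

/-- Coin `i` is fair; its value is sent to the cryptographers `i` and `i - 1` modulo 3. -/
noncomputable def coin (i : Fin 3) : Proc Chan Lab :=
  .prob ⟨.l9 i, []⟩ 2 (PMF.uniformOfFintype (Fin 2)) fun v =>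
    .par (.sendBit (.l10 i) (.c i i) (v == 1)) (.sendBit (.l11 i) (.c (i - 1) i) (v == 1))

/-- The restricted channels between the master and the cryptographers. -/
def mChans : List Chan := (List.finRange 3).flatMap fun i => [.m i false, .m i true]

/-- The restricted channels between the coins and the cryptographers. -/
def cChans : List Chan := (List.finRange 3).flatMap fun i =>
  [.c i i false, .c i i true, .c i (i + 1) false, .c i (i + 1) true]

/-- The protocol. -/
noncomputable def prot (p : PMF (Fin 3)) : Proc Chan Lab :=
  .resAll mChans (.par (master p) (.resAll cChans (.par (.par3 crypt) (.par3 coin))))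

/-- The executions in which the master has selected cryptographer `i` as the payer, that is, which
reach a state where the master has just become the branch `i` of his probabilistic choice. -/
def Selected {X : Type u} (i : Fin 3) : Set (Exec (Proc Chan Lab × X) (Act Chan)) :=
  {e : List (Act Chan × (Proc Chan Lab × X)) |
    ∃ s ∈ e, ∃ R, s.2.1 = .resAll mChans (.par (masterBranch i) R)}

/-- The executions whose sequence of visible actions is the sequence `o` of announcements
`(i, b)`, "cryptographer `i` announces the bit `b`". -/
def Produces {X : Type u} (o : List (Fin 3 × Bool)) :
    Set (Exec (Proc Chan Lab × X) (Act Chan)) :=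
  {e : List (Act Chan × (Proc Chan Lab × X)) |
    (e.map Prod.fst).filter Act.isVisible = o.map fun ib => .out (.out ib.1 ib.2)}

end DiningCryptographers

/-! ## Inversion of the transition rules -/

namespace CCSSigma

variable {C L : Type}

/-! A scheduler sees labels only, and which labels can act does not depend on the transmitted bits.
A reachable state is described by a `Progress` (which choices have been made, how far each
cryptographer is) and an `Outcome` (payer and coins), of which only the choices already made matter
(`protAt_congr`). Which moves are possible, and the progress after them, depend on the progress
alone (`step_protAt_iff`), and distinct labels make a command determine its move. So the scheduler,
sums included, picks the same move whatever the outcome (`trans_protAt`). Moves run out, hence each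
scheduler amounts to one fixed finite list of moves.

Therefore the random choices can be drawn in advance. Redrawing one coordinate of the product
distribution `outcomes p` leaves it unchanged (`outcomes_bind_resample`), and induction on the
remaining moves (`exists_trace`) shows that the execution measure is the image of `outcomes p` under
the deterministic map `run`. In particular its total mass is 1.

Finally, replacing the payer `i` by some `j ≠ i` inverts the announcements of `i` and `j`; so does
inverting the coin that these two share. Doing both leaves every announcement unchanged
(`exists_mask`), and translation preserves the uniform distribution of the coins. Hence selecting
`i` and observing `o` has probability `p i` times a number independent of `i`, the selection alone
likewise, and `p i` cancels in the conditional probability. -/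

theorem step_act_iff {l : Label L} {β : Act C} {P : Proc C L} {κ : Cmd L} {α : Act C}
    {μ : PMF (Proc C L)} :
    Step (.act l β P) κ α μ ↔ κ = .single l ∧ α = β ∧ μ = PMF.pure P := by
  constructor
  · rintro ⟨⟩
    exact ⟨rfl, rfl, rfl⟩
  · rintro ⟨rfl, rfl, rfl⟩
    exact .act _ _ _

theorem not_step_nil {κ : Cmd L} {α : Act C} {μ : PMF (Proc C L)} : ¬ Step .nil κ α μ := by
  rintro ⟨⟩

theorem step_prob_iff {l : Label L} {n : ℕ} {p : PMF (Fin n)} {P : Fin n → Proc C L} {κ : Cmd L}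
    {α : Act C} {μ : PMF (Proc C L)} :
    Step (.prob l n p P) κ α μ ↔ κ = .single l ∧ α = .tau ∧ μ = p.map P := by
  constructor
  · rintro ⟨⟩
    exact ⟨rfl, rfl, rfl⟩
  · rintro ⟨rfl, rfl, rfl⟩
    exact .prob _ _ _ _

theorem step_choice_iff {P Q : Proc C L} {κ : Cmd L} {α : Act C} {μ : PMF (Proc C L)} :
    Step (.choice P Q) κ α μ ↔ Step P κ α μ ∨ Step Q κ α μ := by
  constructor
  · intro h
    cases h with
    | sum1 _ h => exact .inl h
    | sum2 _ h => exact .inr h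
  · rintro (h | h)
    exacts [.sum1 _ h, .sum2 _ h]

theorem step_res_iff {a : C} {P : Proc C L} {κ : Cmd L} {α : Act C} {μ : PMF (Proc C L)} :
    Step (.res a P) κ α μ ↔
      ∃ ν, Step P κ α ν ∧ (α ≠ .inp a ∧ α ≠ .out a) ∧ μ = ν.map (Proc.res a) := by
  constructor
  · intro h
    cases h with
    | res _ h h₁ h₂ => exact ⟨_, h, ⟨h₁, h₂⟩, rfl⟩
  · rintro ⟨ν, h, ⟨h₁, h₂⟩, rfl⟩
    exact .res _ h h₁ h₂

theorem step_resAll_iff {as : List C} {P : Proc C L} {κ : Cmd L} {α : Act C}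
    {μ : PMF (Proc C L)} :
    Step (.resAll as P) κ α μ ↔
      ∃ ν, Step P κ α ν ∧ (∀ a ∈ as, α ≠ .inp a ∧ α ≠ .out a) ∧ μ = ν.map (Proc.resAll as) := by
  induction as generalizing μ with
  | nil => simp [show Proc.resAll ([] : List C) = (id : Proc C L → Proc C L) from rfl, PMF.map_id]
  | cons a as ih =>
    rw [show Proc.resAll (a :: as) P = Proc.res a (Proc.resAll as P) from rfl, step_res_iff]
    constructor
    · rintro ⟨ν', h', ha, rfl⟩
      obtain ⟨ν, h, has, rfl⟩ := ih.1 h'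
      exact ⟨ν, h, List.forall_mem_cons.2 ⟨ha, has⟩, by rw [PMF.map_comp]; rfl⟩
    · rintro ⟨ν, h, has, rfl⟩
      rw [List.forall_mem_cons] at has
      exact ⟨_, ih.2 ⟨ν, h, has.2, rfl⟩, has.1, by rw [PMF.map_comp]; rfl⟩

theorem step_par_iff {P Q : Proc C L} {κ : Cmd L} {α : Act C} {μ : PMF (Proc C L)} :
    Step (.par P Q) κ α μ ↔
      (∃ ν, Step P κ α ν ∧ μ = ν.map fun P' => .par P' Q) ∨
      (∃ ν, Step Q κ α ν ∧ μ = ν.map fun Q' => .par P Q') ∨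
      ∃ l₁ l₂ β P' Q', β ≠ .tau ∧ Step P (.single l₁) β (PMF.pure P') ∧
        Step Q (.single l₂) β.co (PMF.pure Q') ∧ κ = .sync l₁ l₂ ∧ α = .tau ∧
        μ = PMF.pure (.par P' Q') := by
  constructor
  · intro h
    cases h with
    | par1 _ h => exact .inl ⟨_, h, rfl⟩
    | par2 _ h => exact .inr (.inl ⟨_, h, rfl⟩)
    | com h h₁ h₂ => exact .inr (.inr ⟨_, _, _, _, _, h, h₁, h₂, rfl, rfl, rfl⟩)
  · rintro (⟨ν, h, rfl⟩ | ⟨ν, h, rfl⟩ | ⟨l₁, l₂, β, P', Q', h, h₁, h₂, rfl, rfl, rfl⟩)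
    exacts [.par1 _ h, .par2 _ h, .com h h₁ h₂]

/-- All actions of `P` belong to `A`. -/
def ActsIn (A : Set (Act C)) (P : Proc C L) : Prop :=
  ∀ ⦃κ α μ⦄, Step P κ α μ → α ∈ A

/-- No two actions in `A` can synchronize. -/
def NoComplements (A : Set (Act C)) : Prop := ∀ α ∈ A, α ≠ .tau → α.co ∉ A

/-- Covers components of the same kind (messages of the master, cryptographers, coins), which never
talk to each other, so that the communication rule is void. -/
theorem step_par_iff_of_noComplements {A : Set (Act C)} (hA : NoComplements A) {P Q : Proc C L}
    (hP : ActsIn A P) (hQ : ActsIn A Q) {κ : Cmd L} {α : Act C} {μ : PMF (Proc C L)} :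
    Step (.par P Q) κ α μ ↔
      (∃ ν, Step P κ α ν ∧ μ = ν.map fun P' => .par P' Q) ∨
      (∃ ν, Step Q κ α ν ∧ μ = ν.map fun Q' => .par P Q') := by
  rw [step_par_iff]
  refine ⟨?_, ?_⟩
  · rintro (h | h | ⟨l₁, l₂, β, P', Q', h, h₁, h₂, -⟩)
    exacts [.inl h, .inr h, (hA _ (hP h₁) h (hQ h₂)).elim]
  · rintro (h | h)
    exacts [.inl h, .inr (.inl h)]

theorem ActsIn.par {A : Set (Act C)} (hA : NoComplements A) {P Q : Proc C L}
    (hP : ActsIn A P) (hQ : ActsIn A Q) : ActsIn A (.par P Q) := by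
  intro κ α μ h
  rcases (step_par_iff_of_noComplements hA hP hQ).1 h with ⟨ν, h, -⟩ | ⟨ν, h, -⟩
  exacts [hP h, hQ h]

theorem step_par3_iff {A : Set (Act C)} (hA : NoComplements A) {P : Fin 3 → Proc C L}
    (hP : ∀ k, ActsIn A (P k)) {κ : Cmd L} {α : Act C} {μ : PMF (Proc C L)} :
    Step (.par3 P) κ α μ ↔
      ∃ k ν, Step (P k) κ α ν ∧ μ = ν.map fun Q => .par3 (Function.update P k Q) := by
  rw [Proc.par3, step_par_iff_of_noComplements hA ((hP 0).par hA (hP 1)) (hP 2)]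
  constructor
  · rintro (⟨ν', h', rfl⟩ | ⟨ν, h, rfl⟩)
    · rcases (step_par_iff_of_noComplements hA (hP 0) (hP 1)).1 h' with ⟨ν, h, rfl⟩ | ⟨ν, h, rfl⟩
      · exact ⟨0, ν, h, by rw [PMF.map_comp]; rfl⟩
      · exact ⟨1, ν, h, by rw [PMF.map_comp]; rfl⟩
    · exact ⟨2, ν, h, rfl⟩
  · rintro ⟨k, ν, h, rfl⟩
    simp only [step_par_iff_of_noComplements hA (hP 0) (hP 1)]
    match k with
    | 0 => exact .inl ⟨_, .inl ⟨ν, h, rfl⟩, by rw [PMF.map_comp]; rfl⟩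
    | 1 => exact .inl ⟨_, .inr ⟨ν, h, rfl⟩, by rw [PMF.map_comp]; rfl⟩
    | 2 => exact .inr ⟨ν, h, rfl⟩

theorem step_recvBit_iff {l : L} {c : Bool → C} {P : Bool → Proc C L} {κ : Cmd L} {α : Act C}
    {μ : PMF (Proc C L)} :
    Step (.recvBit l c P) κ α μ ↔
      ∃ b, κ = .single ⟨l, []⟩ ∧ α = .inp (c b) ∧ μ = PMF.pure (P b) := by
  simp [Proc.recvBit, step_choice_iff, step_act_iff, and_or_left]

theorem step_sendBit_iff {l : L} {c : Bool → C} {b : Bool} {κ : Cmd L} {α : Act C}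
    {μ : PMF (Proc C L)} :
    Step (.sendBit l c b) κ α μ ↔
      κ = .single ⟨l, []⟩ ∧ α = .out (c b) ∧ μ = PMF.pure .nil := step_act_iff

/-- A secret output of a bit that may have happened. -/
def Proc.sendBitUnless (sent : Bool) (l : L) (c : Bool → C) (b : Bool) : Proc C L :=
  bif sent then .nil else .sendBit l c b

theorem step_sendBitUnless_iff {sent : Bool} {l : L} {c : Bool → C} {b : Bool} {κ : Cmd L}
    {α : Act C} {μ : PMF (Proc C L)} :
    Step (.sendBitUnless sent l c b) κ α μ ↔
      sent = false ∧ κ = .single ⟨l, []⟩ ∧ α = .out (c b) ∧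
        μ = PMF.pure (.sendBitUnless true l c b) := by
  cases sent
  · simp [Proc.sendBitUnless, step_sendBit_iff]
  · simp [Proc.sendBitUnless, not_step_nil]

end CCSSigma

/-! ## Executions of probabilistic automata -/

namespace ProbAut

variable {Q : Type u} {A : Type v}

/-- The expectation of `f` over the finite complete executions that start in `s`. -/
noncomputable def expect (M : ProbAut Q A) (s : Q) (f : List (A × Q) → ℝ≥0∞) : ℝ≥0∞ :=
  -- The supremum over a false proposition is 0, so only complete executions contribute.
  ∑' e, ⨆ _ : M.Deadlocked (lastState s e), M.coneProb s e * f e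

theorem tsum_list {α : Type*} (f : List α → ℝ≥0∞) :
    ∑' l, f l = f [] + ∑' (a : α) (l : List α), f (a :: l) := by
  let g : Unit ⊕ α × List α ≃ List α :=
    { toFun := Sum.elim (fun _ => []) fun x => x.1 :: x.2
      invFun := fun l => l.casesOn (.inl ()) fun a l => .inr (a, l)
      left_inv := by rintro (_ | _) <;> rfl
      right_inv := by rintro (_ | _) <;> rfl }
  rw [← g.tsum_eq, Summable.tsum_sum ENNReal.summable ENNReal.summable, ENNReal.tsum_prod']
  simp [g]

theorem expect_of_deadlocked {M : ProbAut Q A} {s : Q} (h : M.Deadlocked s)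
    (f : List (A × Q) → ℝ≥0∞) : M.expect s f = f [] := by
  have h₀ (a : A) (t : Q) : M.stepProb s a t = 0 :=
    ENNReal.tsum_eq_zero.2 fun μ => (h a μ.1 μ.2).elim
  rw [expect, tsum_list]
  simp [lastState, coneProb, h, h₀]

theorem stepProb_eq {M : ProbAut Q A} {s : Q} {a : A} {μ : PMF Q} (h : M.trans s a μ)
    (hu : ∀ b ν, M.trans s b ν → b = a ∧ ν = μ) (t : Q) : M.stepProb s a t = μ t := by
  have : Unique {ν : PMF Q // M.trans s a ν} :=
    { default := ⟨μ, h⟩, uniq := fun ν => Subtype.ext (hu a ν.1 ν.2).2 }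
  exact tsum_eq_single (⟨μ, h⟩ : {ν : PMF Q // M.trans s a ν})
    fun ν hν => (hν (Subtype.ext (hu a ν.1 ν.2).2)).elim

theorem stepProb_eq_zero {M : ProbAut Q A} {s : Q} {a b : A} {μ : PMF Q}
    (hu : ∀ b ν, M.trans s b ν → b = a ∧ ν = μ) (hb : b ≠ a) (t : Q) : M.stepProb s b t = 0 :=
  ENNReal.tsum_eq_zero.2 fun ν => (hb (hu b ν.1 ν.2).1).elim

/-- Conditioning on the first step: the empty execution is not complete, and every action other than
`a` has step probability 0. -/
theorem expect_of_trans {M : ProbAut Q A} {s : Q} {a : A} {μ : PMF Q} (h : M.trans s a μ)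
    (hu : ∀ b ν, M.trans s b ν → b = a ∧ ν = μ) (f : List (A × Q) → ℝ≥0∞) :
    M.expect s f = ∑' t, μ t * M.expect t fun e => f ((a, t) :: e) := by
  have hs : ¬ M.Deadlocked s := fun hs => hs _ _ h
  rw [expect, tsum_list, ENNReal.tsum_prod', tsum_eq_single a]
  · simp only [lastState, coneProb, hs, ciSup_false, bot_eq_zero, zero_add, stepProb_eq h hu]
    refine tsum_congr fun t => ?_
    rw [expect, ← ENNReal.tsum_mul_left]
    refine tsum_congr fun e => ?_
    simp only [ENNReal.mul_iSup, mul_assoc]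
  · intro b hb
    simp [coneProb, stepProb_eq_zero hu hb]

theorem execMeasure_apply (M : ProbAut Q A) (B : Set (Exec Q A)) :
    M.execMeasure B = M.expect M.init (B.indicator 1) := by
  rw [execMeasure, MeasureTheory.Measure.sum_apply _ MeasurableSpace.measurableSet_top]
  refine (tsum_subtype {e : Exec Q A | M.Complete e} fun e =>
    (M.coneProb M.init e • MeasureTheory.Measure.dirac e :
      MeasureTheory.Measure (Exec Q A)) B).trans ?_
  refine tsum_congr fun e => ?_
  by_cases he : M.Deadlocked (lastState M.init e)
  · rw [Set.indicator_of_mem (by exact he), iSup_pos he, MeasureTheory.Measure.smul_apply,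
      MeasureTheory.Measure.dirac_apply' _ MeasurableSpace.measurableSet_top, smul_eq_mul]
  · rw [Set.indicator_of_notMem (by exact he), iSup_neg he, bot_eq_zero]

end ProbAut

namespace DiningCryptographers

open CCSSigma Function

/-! ## The components of the protocol -/

/-- The master after he has selected a payer if `sel` holds, and has informed the cryptographers
`k` with `sent k`. -/
noncomputable def masterAt (p : PMF (Fin 3)) (sel : Bool) (sent : Fin 3 → Bool) (i : Fin 3) :
    Proc Chan Lab :=
  bif sel then .par3 fun k => .sendBitUnless (sent k) (.lm k) (.m k) (i == k) else master p

/-- Cryptographer `k` after his first `n` actions, with the bits that he has received. -/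
def cryptAt (k : Fin 3) (n : ℕ) (pay coin₁ coin₂ : Bool) : Proc Chan Lab :=
  match n with
  | 0 => crypt k
  | 1 => .recvBit (.l6 k) (.c k k) fun coin₁ =>
      .recvBit (.l7 k) (.c k (k + 1)) fun coin₂ =>
      .sendBit (.l8 k) (.out k) (xor pay (xor coin₁ coin₂))
  | 2 => .recvBit (.l7 k) (.c k (k + 1)) fun coin₂ =>
      .sendBit (.l8 k) (.out k) (xor pay (xor coin₁ coin₂))
  | 3 => .sendBit (.l8 k) (.out k) (xor pay (xor coin₁ coin₂))
  | _ => .nil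

/-- Coin `k` after it has been flipped with outcome `v` if `flip` holds, and after it has been sent
to cryptographer `k` (`k - 1`) if `sent₁` (`sent₂`) holds. -/
noncomputable def coinAt (k : Fin 3) (flip sent₁ sent₂ : Bool) (v : Fin 2) : Proc Chan Lab :=
  bif flip then
    .par (.sendBitUnless sent₁ (.l10 k) (.c k k) (v == 1))
      (.sendBitUnless sent₂ (.l11 k) (.c (k - 1) k) (v == 1))
  else coin k

noncomputable def cryptsAt (n : Fin 3 → ℕ) (pay coin₁ coin₂ : Fin 3 → Bool) : Proc Chan Lab :=
  .par3 fun k => cryptAt k (n k) (pay k) (coin₁ k) (coin₂ k)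

noncomputable def coinsAt (flip sent₁ sent₂ : Fin 3 → Bool) (v : Fin 3 → Fin 2) : Proc Chan Lab :=
  .par3 fun k => coinAt k (flip k) (sent₁ k) (sent₂ k) (v k)

/-! ### Their transitions -/

def masterActs : Set (Act Chan) := {α | α = .tau ∨ ∃ k b, α = .out (.m k b)}

def coinActs : Set (Act Chan) := {α | α = .tau ∨ ∃ j k b, α = .out (.c j k b)}

def cryptActs : Set (Act Chan) :=
  {α | (∃ k b, α = .inp (.m k b)) ∨ (∃ j k b, α = .inp (.c j k b)) ∨ ∃ k b, α = .out (.out k b)}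

theorem noComplements_masterActs : NoComplements masterActs := by
  rintro α (rfl | ⟨k, b, rfl⟩) h <;> simp_all [masterActs, Act.co]

theorem noComplements_coinActs : NoComplements coinActs := by
  rintro α (rfl | ⟨j, k, b, rfl⟩) h <;> simp_all [coinActs, Act.co]

theorem noComplements_cryptActs : NoComplements cryptActs := by
  rintro α (⟨k, b, rfl⟩ | ⟨j, k, b, rfl⟩ | ⟨k, b, rfl⟩) h <;> simp [cryptActs, Act.co]

variable {κ : Cmd Lab} {α : Act Chan} {μ : PMF (Proc Chan Lab)}

theorem step_masterAt_iff {p : PMF (Fin 3)} {sel : Bool} {sent : Fin 3 → Bool} {i : Fin 3} :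
    Step (masterAt p sel sent i) κ α μ ↔
      (sel = false ∧ κ = .single ⟨.l1, []⟩ ∧ α = .tau ∧ μ = p.map masterBranch) ∨
      (sel = true ∧ ∃ k, sent k = false ∧ κ = .single ⟨.lm k, []⟩ ∧ α = .out (.m k (i == k)) ∧
        μ = PMF.pure (masterAt p true (update sent k true) i)) := by
  cases sel
  · simp [masterAt, master, step_prob_iff]
  · have hA (k : Fin 3) : ActsIn masterActs
        (Proc.sendBitUnless (sent k) (.lm k) (.m k) (i == k) : Proc Chan Lab) := by
      intro κ α μ h
      obtain ⟨-, -, rfl, -⟩ := step_sendBitUnless_iff.1 h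
      exact .inr ⟨_, _, rfl⟩
    have hu (k : Fin 3) :
        update (fun k => (Proc.sendBitUnless (sent k) (.lm k) (.m k) (i == k) : Proc Chan Lab)) k
          (Proc.sendBitUnless true (.lm k) (.m k) (i == k)) =
        fun j => Proc.sendBitUnless (update sent k true j) (.lm j) (.m j) (i == j) := by
      funext j
      by_cases h : j = k
      · subst h; simp
      · simp [h]
    simp only [masterAt, cond_true, step_par3_iff noComplements_masterActs hA,
      step_sendBitUnless_iff]
    constructor
    · rintro ⟨k, ν, ⟨h, rfl, rfl, rfl⟩, rfl⟩
      exact .inr ⟨trivial, k, h, rfl, rfl, by rw [PMF.pure_map, hu]⟩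
    · rintro (⟨h, -⟩ | ⟨-, k, h, rfl, rfl, rfl⟩)
      · cases h
      · exact ⟨k, _, ⟨h, rfl, rfl, rfl⟩, by rw [PMF.pure_map, hu]⟩

theorem step_cryptAt_iff {k : Fin 3} {n : ℕ} {pay coin₁ coin₂ : Bool} :
    Step (cryptAt k n pay coin₁ coin₂) κ α μ ↔
      (n = 0 ∧ ∃ b, κ = .single ⟨.l5 k, []⟩ ∧ α = .inp (.m k b) ∧
        μ = PMF.pure (cryptAt k 1 b coin₁ coin₂)) ∨
      (n = 1 ∧ ∃ b, κ = .single ⟨.l6 k, []⟩ ∧ α = .inp (.c k k b) ∧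
        μ = PMF.pure (cryptAt k 2 pay b coin₂)) ∨
      (n = 2 ∧ ∃ b, κ = .single ⟨.l7 k, []⟩ ∧ α = .inp (.c k (k + 1) b) ∧
        μ = PMF.pure (cryptAt k 3 pay coin₁ b)) ∨
      (n = 3 ∧ κ = .single ⟨.l8 k, []⟩ ∧ α = .out (.out k (xor pay (xor coin₁ coin₂))) ∧
        μ = PMF.pure (cryptAt k 4 pay coin₁ coin₂)) := by
  match n with
  | 0 => simp [cryptAt, crypt, step_recvBit_iff]
  | 1 => simp [cryptAt, step_recvBit_iff]
  | 2 => simp [cryptAt, step_recvBit_iff]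
  | 3 => simp [cryptAt, step_sendBit_iff]
  | n + 4 => simp [cryptAt, not_step_nil]

theorem actsIn_cryptAt (k : Fin 3) (n : ℕ) (pay coin₁ coin₂ : Bool) :
    ActsIn cryptActs (cryptAt k n pay coin₁ coin₂) := by
  intro κ α μ h
  rcases step_cryptAt_iff.1 h with ⟨-, b, -, rfl, -⟩ | ⟨-, b, -, rfl, -⟩ | ⟨-, b, -, rfl, -⟩ |
    ⟨-, -, rfl, -⟩
  exacts [.inl ⟨_, _, rfl⟩, .inr (.inl ⟨_, _, _, rfl⟩), .inr (.inl ⟨_, _, _, rfl⟩),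
    .inr (.inr ⟨_, _, rfl⟩)]

theorem cryptsAt_update (n : Fin 3 → ℕ) (pay coin₁ coin₂ : Fin 3 → Bool) (k : Fin 3) (n' : ℕ)
    (pay' coin₁' coin₂' : Bool) :
    Proc.par3 (update (fun k => cryptAt k (n k) (pay k) (coin₁ k) (coin₂ k)) k
      (cryptAt k n' pay' coin₁' coin₂')) =
    cryptsAt (update n k n') (update pay k pay') (update coin₁ k coin₁')
      (update coin₂ k coin₂') := by
  rw [cryptsAt]
  congr 1
  funext j
  by_cases h : j = k
  · subst h; simp
  · simp [h]

theorem step_cryptsAt_iff {n : Fin 3 → ℕ} {pay coin₁ coin₂ : Fin 3 → Bool} :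
    Step (cryptsAt n pay coin₁ coin₂) κ α μ ↔ ∃ k,
      (n k = 0 ∧ ∃ b, κ = .single ⟨.l5 k, []⟩ ∧ α = .inp (.m k b) ∧
        μ = PMF.pure (cryptsAt (update n k 1) (update pay k b) coin₁ coin₂)) ∨
      (n k = 1 ∧ ∃ b, κ = .single ⟨.l6 k, []⟩ ∧ α = .inp (.c k k b) ∧
        μ = PMF.pure (cryptsAt (update n k 2) pay (update coin₁ k b) coin₂)) ∨
      (n k = 2 ∧ ∃ b, κ = .single ⟨.l7 k, []⟩ ∧ α = .inp (.c k (k + 1) b) ∧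
        μ = PMF.pure (cryptsAt (update n k 3) pay coin₁ (update coin₂ k b))) ∨
      (n k = 3 ∧ κ = .single ⟨.l8 k, []⟩ ∧
        α = .out (.out k (xor (pay k) (xor (coin₁ k) (coin₂ k)))) ∧
        μ = PMF.pure (cryptsAt (update n k 4) pay coin₁ coin₂)) := by
  rw [cryptsAt, step_par3_iff noComplements_cryptActs fun k => actsIn_cryptAt _ _ _ _ _]
  refine exists_congr fun k => ?_
  simp only [step_cryptAt_iff]
  constructor
  · rintro ⟨ν, ⟨h, b, rfl, rfl, rfl⟩ | ⟨h, b, rfl, rfl, rfl⟩ | ⟨h, b, rfl, rfl, rfl⟩ |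
      ⟨h, rfl, rfl, rfl⟩, rfl⟩
    · exact .inl ⟨h, b, rfl, rfl, by simp [PMF.pure_map, cryptsAt_update]⟩
    · exact .inr (.inl ⟨h, b, rfl, rfl, by simp [PMF.pure_map, cryptsAt_update]⟩)
    · exact .inr (.inr (.inl ⟨h, b, rfl, rfl, by simp [PMF.pure_map, cryptsAt_update]⟩))
    · exact .inr (.inr (.inr ⟨h, rfl, rfl, by simp [PMF.pure_map, cryptsAt_update]⟩))
  · rintro (⟨h, b, rfl, rfl, rfl⟩ | ⟨h, b, rfl, rfl, rfl⟩ | ⟨h, b, rfl, rfl, rfl⟩ |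
      ⟨h, rfl, rfl, rfl⟩)
    · exact ⟨_, .inl ⟨h, b, rfl, rfl, rfl⟩, by simp [PMF.pure_map, cryptsAt_update]⟩
    · exact ⟨_, .inr (.inl ⟨h, b, rfl, rfl, rfl⟩), by simp [PMF.pure_map, cryptsAt_update]⟩
    · exact ⟨_, .inr (.inr (.inl ⟨h, b, rfl, rfl, rfl⟩)), by
        simp [PMF.pure_map, cryptsAt_update]⟩
    · exact ⟨_, .inr (.inr (.inr ⟨h, rfl, rfl, rfl⟩)), by simp [PMF.pure_map, cryptsAt_update]⟩

theorem actsIn_coinAt (k : Fin 3) (flip sent₁ sent₂ : Bool) (v : Fin 2) :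
    ActsIn coinActs (coinAt k flip sent₁ sent₂ v) := by
  cases flip
  · intro κ α μ h
    obtain ⟨-, rfl, -⟩ := step_prob_iff.1 h
    exact .inl rfl
  · refine ActsIn.par noComplements_coinActs ?_ ?_ <;> intro κ α μ h <;>
    · obtain ⟨-, -, rfl, -⟩ := step_sendBitUnless_iff.1 h
      exact .inr ⟨_, _, _, rfl⟩

theorem step_coinAt_iff {k : Fin 3} {flip sent₁ sent₂ : Bool} {v : Fin 2} :
    Step (coinAt k flip sent₁ sent₂ v) κ α μ ↔
      (flip = false ∧ κ = .single ⟨.l9 k, []⟩ ∧ α = .tau ∧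
        μ = (PMF.uniformOfFintype (Fin 2)).map (coinAt k true false false)) ∨
      (flip = true ∧ sent₁ = false ∧ κ = .single ⟨.l10 k, []⟩ ∧ α = .out (.c k k (v == 1)) ∧
        μ = PMF.pure (coinAt k true true sent₂ v)) ∨
      (flip = true ∧ sent₂ = false ∧ κ = .single ⟨.l11 k, []⟩ ∧
        α = .out (.c (k - 1) k (v == 1)) ∧ μ = PMF.pure (coinAt k true sent₁ true v)) := by
  cases flip
  · simp [coinAt, coin, step_prob_iff, Proc.sendBitUnless]
    exact fun _ _ => Iff.rfl
  · have hA (s : Bool) (l : Lab) (j : Fin 3) : ActsIn coinActs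
        (Proc.sendBitUnless s l (.c j k) (v == 1) : Proc Chan Lab) := by
      intro κ α μ h
      obtain ⟨-, -, rfl, -⟩ := step_sendBitUnless_iff.1 h
      exact .inr ⟨_, _, _, rfl⟩
    simp only [coinAt, cond_true,
      step_par_iff_of_noComplements noComplements_coinActs (hA _ _ _) (hA _ _ _),
      step_sendBitUnless_iff]
    constructor
    · rintro (⟨ν, ⟨h, rfl, rfl, rfl⟩, rfl⟩ | ⟨ν, ⟨h, rfl, rfl, rfl⟩, rfl⟩)
      · exact .inr (.inl ⟨trivial, h, rfl, rfl, by rw [PMF.pure_map]⟩)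
      · exact .inr (.inr ⟨trivial, h, rfl, rfl, by rw [PMF.pure_map]⟩)
    · rintro (⟨h, -⟩ | ⟨-, h, rfl, rfl, rfl⟩ | ⟨-, h, rfl, rfl, rfl⟩)
      · cases h
      · exact .inl ⟨_, ⟨h, rfl, rfl, rfl⟩, by rw [PMF.pure_map]⟩
      · exact .inr ⟨_, ⟨h, rfl, rfl, rfl⟩, by rw [PMF.pure_map]⟩

theorem coinsAt_update (flip sent₁ sent₂ : Fin 3 → Bool) (v : Fin 3 → Fin 2) (k : Fin 3)
    (flip' sent₁' sent₂' : Bool) (v' : Fin 2) :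
    Proc.par3 (update (fun k => coinAt k (flip k) (sent₁ k) (sent₂ k) (v k)) k
      (coinAt k flip' sent₁' sent₂' v')) =
    coinsAt (update flip k flip') (update sent₁ k sent₁') (update sent₂ k sent₂')
      (update v k v') := by
  rw [coinsAt]
  congr 1
  funext j
  by_cases h : j = k
  · subst h; simp
  · simp [h]

/-- Before a flip the sent flags of a coin have no meaning, so the flip resets them; `target_flip`
shows that in valid states they are false anyway. -/
theorem step_coinsAt_iff {flip sent₁ sent₂ : Fin 3 → Bool} {v : Fin 3 → Fin 2} :
    Step (coinsAt flip sent₁ sent₂ v) κ α μ ↔ ∃ k,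
      (flip k = false ∧ κ = .single ⟨.l9 k, []⟩ ∧ α = .tau ∧
        μ = (PMF.uniformOfFintype (Fin 2)).map fun x => coinsAt (update flip k true)
          (update sent₁ k false) (update sent₂ k false) (update v k x)) ∨
      (flip k = true ∧ sent₁ k = false ∧ κ = .single ⟨.l10 k, []⟩ ∧
        α = .out (.c k k (v k == 1)) ∧ μ = PMF.pure (coinsAt flip (update sent₁ k true) sent₂ v)) ∨
      (flip k = true ∧ sent₂ k = false ∧ κ = .single ⟨.l11 k, []⟩ ∧
        α = .out (.c (k - 1) k (v k == 1)) ∧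
        μ = PMF.pure (coinsAt flip sent₁ (update sent₂ k true) v)) := by
  rw [coinsAt, step_par3_iff noComplements_coinActs fun k => actsIn_coinAt _ _ _ _ _]
  refine exists_congr fun k => ?_
  simp only [step_coinAt_iff]
  have hu (h : flip k = true) : update flip k true = flip := by simp [← h]
  constructor
  · rintro ⟨ν, ⟨h, rfl, rfl, rfl⟩ | ⟨h, h', rfl, rfl, rfl⟩ | ⟨h, h', rfl, rfl, rfl⟩, rfl⟩
    · exact .inl ⟨h, rfl, rfl, by simp [PMF.map_comp, comp_def, coinsAt_update]⟩
    · exact .inr (.inl ⟨h, h', rfl, rfl, by simp [PMF.pure_map, coinsAt_update, hu h]⟩)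
    · exact .inr (.inr ⟨h, h', rfl, rfl, by simp [PMF.pure_map, coinsAt_update, hu h]⟩)
  · rintro (⟨h, rfl, rfl, rfl⟩ | ⟨h, h', rfl, rfl, rfl⟩ | ⟨h, h', rfl, rfl, rfl⟩)
    · exact ⟨_, .inl ⟨h, rfl, rfl, rfl⟩, by simp [PMF.map_comp, comp_def, coinsAt_update]⟩
    · exact ⟨_, .inr (.inl ⟨h, h', rfl, rfl, rfl⟩), by
        simp [PMF.pure_map, coinsAt_update, hu h]⟩
    · exact ⟨_, .inr (.inr ⟨h, h', rfl, rfl, rfl⟩), by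
        simp [PMF.pure_map, coinsAt_update, hu h]⟩

end DiningCryptographers

/-! ### Cryptographers and coins under the restriction of the coin channels -/

namespace DiningCryptographers

open CCSSigma Function

variable {κ : Cmd Lab} {α : Act Chan} {μ : PMF (Proc Chan Lab)}

theorem pure_eq_pure {β : Type*} {a b : β} : PMF.pure a = PMF.pure b ↔ a = b := by
  refine ⟨fun h => ?_, fun h => h ▸ rfl⟩
  simpa [h] using (PMF.support_pure a).symm.trans (congrArg PMF.support h)

/-- The cryptographers and the coins. -/
noncomputable def tableAt (n : Fin 3 → ℕ) (pay coin₁ coin₂ flip sent₁ sent₂ : Fin 3 → Bool)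
    (v : Fin 3 → Fin 2) : Proc Chan Lab :=
  .resAll cChans (.par (cryptsAt n pay coin₁ coin₂) (coinsAt flip sent₁ sent₂ v))

theorem mem_cChans {a : Chan} : a ∈ cChans ↔ ∃ k b, a = .c k k b ∨ a = .c k (k + 1) b := by
  simp only [cChans, List.mem_flatMap, List.mem_finRange, true_and, List.mem_cons,
    List.not_mem_nil, or_false, Bool.exists_bool]
  exact exists_congr fun k => by tauto

theorem mem_mChans {a : Chan} : a ∈ mChans ↔ ∃ k b, a = .m k b := by
  simp [mChans]

/-- The restriction forbids a coin channel to act alone, so coin values move only by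
synchronization. Matching channels then identify the coin and force the received bit to be its
value. -/
theorem step_tableAt_iff {n : Fin 3 → ℕ} {pay coin₁ coin₂ flip sent₁ sent₂ : Fin 3 → Bool}
    {v : Fin 3 → Fin 2} :
    Step (tableAt n pay coin₁ coin₂ flip sent₁ sent₂ v) κ α μ ↔ ∃ k,
      (n k = 0 ∧ ∃ b, κ = .single ⟨.l5 k, []⟩ ∧ α = .inp (.m k b) ∧
        μ = PMF.pure (tableAt (update n k 1) (update pay k b) coin₁ coin₂ flip sent₁ sent₂ v)) ∨
      (n k = 3 ∧ κ = .single ⟨.l8 k, []⟩ ∧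
        α = .out (.out k (xor (pay k) (xor (coin₁ k) (coin₂ k)))) ∧
        μ = PMF.pure (tableAt (update n k 4) pay coin₁ coin₂ flip sent₁ sent₂ v)) ∨
      (flip k = false ∧ κ = .single ⟨.l9 k, []⟩ ∧ α = .tau ∧
        μ = (PMF.uniformOfFintype (Fin 2)).map fun x => tableAt n pay coin₁ coin₂
          (update flip k true) (update sent₁ k false) (update sent₂ k false) (update v k x)) ∨
      (n k = 1 ∧ flip k = true ∧ sent₁ k = false ∧
        κ = .sync ⟨.l6 k, []⟩ ⟨.l10 k, []⟩ ∧ α = .tau ∧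
        μ = PMF.pure (tableAt (update n k 2) pay (update coin₁ k (v k == 1)) coin₂ flip
          (update sent₁ k true) sent₂ v)) ∨
      (n k = 2 ∧ flip (k + 1) = true ∧ sent₂ (k + 1) = false ∧
        κ = .sync ⟨.l7 k, []⟩ ⟨.l11 (k + 1), []⟩ ∧ α = .tau ∧
        μ = PMF.pure (tableAt (update n k 3) pay coin₁ (update coin₂ k (v (k + 1) == 1)) flip
          sent₁ (update sent₂ (k + 1) true) v)) := by
  -- These exclude the mixed pairs, where a cryptographer's input from his own coin would meet an
  -- output to a predecessor, or an input from the next coin an output to the coin's owner.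
  have hk₁ (k : Fin 3) : k ≠ k - 1 := by revert k; decide
  have hk₂ (k : Fin 3) : k + 1 ≠ k := by revert k; decide
  rw [tableAt, step_resAll_iff]
  constructor
  · rintro ⟨ν, hs, hα, rfl⟩
    rcases step_par_iff.1 hs with ⟨ν, hν, rfl⟩ | ⟨ν, hν, rfl⟩ |
      ⟨l₁, l₂, β, P', Q', hβ, h₁, h₂, rfl, rfl, rfl⟩
    · obtain ⟨k, ⟨h, b, rfl, rfl, rfl⟩ | ⟨h, b, rfl, rfl, rfl⟩ | ⟨h, b, rfl, rfl, rfl⟩ |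
        ⟨h, rfl, rfl, rfl⟩⟩ := step_cryptsAt_iff.1 hν
      · exact ⟨k, .inl ⟨h, b, rfl, rfl, by simp only [PMF.pure_map]; rfl⟩⟩
      · exact ((hα _ (mem_cChans.2 ⟨_, _, .inl rfl⟩)).1 rfl).elim
      · exact ((hα _ (mem_cChans.2 ⟨_, _, .inr rfl⟩)).1 rfl).elim
      · exact ⟨k, .inr (.inl ⟨h, rfl, rfl, by simp only [PMF.pure_map]; rfl⟩)⟩
    · obtain ⟨k, ⟨h, rfl, rfl, rfl⟩ | ⟨h, h', rfl, rfl, rfl⟩ | ⟨h, h', rfl, rfl, rfl⟩⟩ :=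
        step_coinsAt_iff.1 hν
      · exact ⟨k, .inr (.inr (.inl ⟨h, rfl, rfl, by simp only [PMF.map_comp]; rfl⟩))⟩
      · exact ((hα _ (mem_cChans.2 ⟨_, _, .inl rfl⟩)).2 rfl).elim
      · exact ((hα _ (mem_cChans.2 ⟨k - 1, _, .inr (by rw [sub_add_cancel])⟩)).2 rfl).elim
    · obtain ⟨k, ⟨h, b, h_κ, rfl, hP⟩ | ⟨h, b, h_κ, rfl, hP⟩ | ⟨h, b, h_κ, rfl, hP⟩ |
          ⟨h, h_κ, rfl, hP⟩⟩ := step_cryptsAt_iff.1 h₁ <;>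
        obtain ⟨j, ⟨h', h_κ', h_α, hQ⟩ | ⟨h', h'', h_κ', h_α, hQ⟩ | ⟨h', h'', h_κ', h_α, hQ⟩⟩ :=
          step_coinsAt_iff.1 h₂ <;>
        simp only [Act.co, Act.out.injEq, Chan.c.injEq, reduceCtorEq] at h_α <;>
        simp only [Cmd.single.injEq] at h_κ h_κ' <;>
        subst h_κ h_κ' <;>
        obtain ⟨rfl, h_k, rfl⟩ := h_α
      · rw [pure_eq_pure] at hP hQ
        subst hP hQ
        exact ⟨k, .inr (.inr (.inr (.inl ⟨h, h', h'', rfl, rfl, by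
          simp only [PMF.pure_map]; rfl⟩)))⟩
      · exact (hk₁ _ h_k.symm).elim
      · exact (hk₂ _ h_k).elim
      · rw [pure_eq_pure] at hP hQ
        subst hP hQ
        obtain ⟨k, rfl⟩ : ∃ k, j = k + 1 := ⟨j - 1, h_k.symm⟩
        rw [add_sub_cancel_right] at h ⊢
        exact ⟨k, .inr (.inr (.inr (.inr ⟨h, h', h'', rfl, rfl, by
          simp only [PMF.pure_map]; rfl⟩)))⟩
  · rintro ⟨k, ⟨h, b, rfl, rfl, rfl⟩ | ⟨h, rfl, rfl, rfl⟩ | ⟨h, rfl, rfl, rfl⟩ |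
      ⟨h, h', h'', rfl, rfl, rfl⟩ | ⟨h, h', h'', rfl, rfl, rfl⟩⟩
    · refine ⟨_, .par1 _ (step_cryptsAt_iff.2 ⟨k, .inl ⟨h, b, rfl, rfl, rfl⟩⟩), ?_, by
        simp only [PMF.pure_map]; rfl⟩
      intro a ha
      obtain ⟨j, c, rfl | rfl⟩ := mem_cChans.1 ha <;> simp
    · refine ⟨_, .par1 _ (step_cryptsAt_iff.2 ⟨k, .inr (.inr (.inr ⟨h, rfl, rfl, rfl⟩))⟩), ?_, by
        simp only [PMF.pure_map]; rfl⟩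
      intro a ha
      obtain ⟨j, c, rfl | rfl⟩ := mem_cChans.1 ha <;> simp
    · exact ⟨_, .par2 _ (step_coinsAt_iff.2 ⟨k, .inl ⟨h, rfl, rfl, rfl⟩⟩), by simp, by
        simp only [PMF.map_comp]; rfl⟩
    · exact ⟨_, .com (α := .inp (.c k k (v k == 1))) (by simp)
        (step_cryptsAt_iff.2 ⟨k, .inr (.inl ⟨h, _, rfl, rfl, rfl⟩)⟩)
        (step_coinsAt_iff.2 ⟨k, .inr (.inl ⟨h', h'', rfl, rfl, rfl⟩)⟩), by simp, by
        simp only [PMF.pure_map]; rfl⟩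
    · exact ⟨_, .com (α := .inp (.c k (k + 1) (v (k + 1) == 1))) (by simp)
        (step_cryptsAt_iff.2 ⟨k, .inr (.inr (.inl ⟨h, _, rfl, rfl, rfl⟩))⟩)
        (step_coinsAt_iff.2 ⟨k + 1, .inr (.inr ⟨h', h'', rfl, by
          rw [add_sub_cancel_right]; rfl, rfl⟩)⟩), by simp, by
        simp only [PMF.pure_map]; rfl⟩

/-! ## States and moves of the protocol -/

/-- How far the protocol has proceeded, apart from the outcomes of its probabilistic choices:
whether the payer has been selected, which coins have been flipped, and the number of actions of
each cryptographer. -/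
structure Progress where
  sel : Bool
  flip : Fin 3 → Bool
  stage : Fin 3 → ℕ

/-- The payer and the outcomes of the coins. -/
abbrev Outcome : Type := Fin 3 × (Fin 3 → Fin 2)

/-- The bit that cryptographer `k` announces. -/
def Outcome.announcement (w : Outcome) (k : Fin 3) : Bool :=
  xor (w.1 == k) (xor (w.2 k == 1) (w.2 (k + 1) == 1))

/-- The transitions of the protocol. -/
inductive Move
  | select
  | flip (k : Fin 3)
  | inform (k : Fin 3)
  | recv₁ (k : Fin 3)
  | recv₂ (k : Fin 3)
  | announce (k : Fin 3)

namespace Move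

/-- The command that schedules a move. -/
def cmd : Move → Cmd Lab
  | select => .single ⟨.l1, []⟩
  | flip k => .single ⟨.l9 k, []⟩
  | inform k => .sync ⟨.lm k, []⟩ ⟨.l5 k, []⟩
  | recv₁ k => .sync ⟨.l6 k, []⟩ ⟨.l10 k, []⟩
  | recv₂ k => .sync ⟨.l7 k, []⟩ ⟨.l11 (k + 1), []⟩
  | announce k => .single ⟨.l8 k, []⟩

/-- Distinctness of labels: this is how a scheduler resolves all nondeterminism. -/
theorem cmd_injective : Injective cmd := by
  rintro (_ | k | k | k | k | k) (_ | j | j | j | j | j) h <;> simp_all [cmd]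

/-- The action of a move. -/
def act (w : Outcome) : Move → Act Chan
  | announce k => .out (.out k (w.announcement k))
  | _ => .tau

/-- The probabilistic choice that is made by a move. -/
noncomputable def resample (p : PMF (Fin 3)) (w : Outcome) : Move → PMF Outcome
  | select => p.map fun i => (i, w.2)
  | flip k => (PMF.uniformOfFintype (Fin 2)).map fun x => (w.1, update w.2 k x)
  | inform _ | recv₁ _ | recv₂ _ | announce _ => PMF.pure w

end Move

namespace Progress

def start : Progress := ⟨false, fun _ => false, fun _ => 0⟩

/-- Sent messages need no record of their own: communication is synchronous, so a message has been
sent exactly when its receiver has passed the corresponding stage. The outcome does not enter. -/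
def Enabled (K : Progress) : Move → Prop
  | .select => K.sel = false
  | .flip k => K.flip k = false
  | .inform k => K.sel = true ∧ K.stage k = 0
  | .recv₁ k => K.stage k = 1 ∧ K.flip k = true
  | .recv₂ k => K.stage k = 2 ∧ K.flip (k + 1) = true
  | .announce k => K.stage k = 3

def next (K : Progress) : Move → Progress
  | .select => { K with sel := true }
  | .flip k => { K with flip := update K.flip k true }
  | .inform k => { K with stage := update K.stage k 1 }
  | .recv₁ k => { K with stage := update K.stage k 2 }
  | .recv₂ k => { K with stage := update K.stage k 3 }
  | .announce k => { K with stage := update K.stage k 4 }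

/-- The cryptographers have only received what has been determined before. -/
structure Valid (K : Progress) : Prop where
  sel : ∀ k, 1 ≤ K.stage k → K.sel = true
  flip₁ : ∀ k, 2 ≤ K.stage k → K.flip k = true
  flip₂ : ∀ k, 3 ≤ K.stage k → K.flip (k + 1) = true

theorem valid_start : start.Valid := ⟨by simp [start], by simp [start], by simp [start]⟩

theorem Valid.next {K : Progress} (hK : K.Valid) {m : Move} (hm : K.Enabled m) :
    (K.next m).Valid := by
  obtain ⟨h₁, h₂, h₃⟩ := hK
  cases m <;> refine ⟨fun j => ?_, fun j => ?_, fun j => ?_⟩ <;>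
    have h₁ := h₁ j <;> have h₂ := h₂ j <;> have h₃ := h₃ j <;>
    simp only [Progress.next, Enabled, update_apply] at hm ⊢ <;> grind

/-- An upper bound for the number of moves that remain. -/
def remaining (K : Progress) : ℕ :=
  (!K.sel).toNat + ∑ k, (!K.flip k).toNat + ∑ k, (4 - K.stage k)

/-- An enabled move sets a flag or raises a stage that is at most 3, so the truncated difference `4
- K.stage k` really drops. The induction in `exists_trace` rests on this. -/
theorem remaining_next_lt {K : Progress} {m : Move} (hm : K.Enabled m) :
    (K.next m).remaining < K.remaining := by
  rcases m with _ | k | k | k | k | k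
  · simp only [Enabled] at hm
    simp [remaining, next, hm]
  all_goals
    fin_cases k <;> simp only [Enabled] at hm <;> simp [remaining, next, Fin.sum_univ_three] <;>
      grind

/-- Outcomes that agree on the probabilistic choices that have been made. -/
def Agree (K : Progress) (w w' : Outcome) : Prop :=
  (K.sel = true → w.1 = w'.1) ∧ ∀ k, K.flip k = true → w.2 k = w'.2 k

theorem Agree.of_next {K : Progress} {m : Move} {w w' : Outcome} (h : (K.next m).Agree w w') :
    K.Agree w w' := by
  obtain ⟨h₁, h₂⟩ := h
  refine ⟨fun hs => h₁ ?_, fun k hk => h₂ k ?_⟩ <;> cases m <;>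
    simp_all [next, update_apply]

/-- Only a choice that has not yet been made is redrawn. -/
theorem agree_of_resample {K : Progress} {m : Move} (hm : K.Enabled m) {p : PMF (Fin 3)}
    {w w' : Outcome} (h : m.resample p w w' ≠ 0) : K.Agree w w' := by
  rw [← PMF.mem_support_iff] at h
  cases m <;> simp only [Move.resample, Enabled, PMF.support_map, PMF.support_pure,
    Set.mem_image, Set.mem_singleton_iff] at h hm
  case select =>
    obtain ⟨i, -, rfl⟩ := h
    exact ⟨fun hs => by simp [hm] at hs, fun _ _ => rfl⟩
  case flip k =>
    obtain ⟨x, -, rfl⟩ := h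
    refine ⟨fun _ => rfl, fun j hj => ?_⟩
    exact (update_of_ne (by rintro rfl; simp [hm] at hj) _ _).symm
  all_goals
    subst h
    exact ⟨fun _ => rfl, fun _ _ => rfl⟩

/-- The outcome shows only in an announcement, which happens at stage 3, when validity guarantees
that the payer and both coins involved are settled. -/
theorem Agree.act_eq {K : Progress} (hK : K.Valid) {m : Move} (hm : K.Enabled m) {w w' : Outcome}
    (h : K.Agree w w') : m.act w = m.act w' := by
  cases m <;> try rfl
  next k =>
    simp only [Enabled] at hm
    simp [Move.act, Outcome.announcement, h.1 (hK.sel k (by omega)),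
      h.2 _ (hK.flip₁ k (by omega)), h.2 _ (hK.flip₂ k (by omega))]

end Progress

theorem cryptsAt_congr {n : Fin 3 → ℕ} {pay coin₁ coin₂ pay' coin₁' coin₂' : Fin 3 → Bool}
    (h₁ : ∀ k, 1 ≤ n k → pay k = pay' k) (h₂ : ∀ k, 2 ≤ n k → coin₁ k = coin₁' k)
    (h₃ : ∀ k, 3 ≤ n k → coin₂ k = coin₂' k) :
    cryptsAt n pay coin₁ coin₂ = cryptsAt n pay' coin₁' coin₂' := by
  rw [cryptsAt, cryptsAt]
  congr 1
  funext k
  replace h₁ := h₁ k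
  replace h₂ := h₂ k
  replace h₃ := h₃ k
  generalize n k = m at *
  match m with
  | 0 => rfl
  | 1 => simp [cryptAt, h₁]
  | 2 => simp [cryptAt, h₁, h₂]
  | 3 => simp [cryptAt, h₁, h₂, h₃]
  | m + 4 => rfl

/-- The cryptographers `k` that have proceeded to stage `t`. -/
def reached (t : ℕ) (n : Fin 3 → ℕ) (k : Fin 3) : Bool := decide (t ≤ n k)

/-- The cryptographers `k` whose predecessors have proceeded to stage `t`. -/
def reachedPred (t : ℕ) (n : Fin 3 → ℕ) (k : Fin 3) : Bool := decide (t ≤ n (k - 1))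

/-- The state of the protocol. -/
noncomputable def protAt (p : PMF (Fin 3)) (K : Progress) (w : Outcome) : Proc Chan Lab :=
  .resAll mChans (.par (masterAt p K.sel (reached 1 K.stage) w.1)
    (tableAt K.stage (fun k => w.1 == k) (fun k => w.2 k == 1) (fun k => w.2 (k + 1) == 1)
      K.flip (reached 2 K.stage) (reachedPred 3 K.stage) w.2))

theorem protAt_start (p : PMF (Fin 3)) (w : Outcome) : protAt p .start w = prot p := rfl

/-- An outcome also fixes choices that are still open; the process term does not mention those. -/
theorem protAt_congr (p : PMF (Fin 3)) {K : Progress} (hK : K.Valid) {w w' : Outcome}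
    (h : K.Agree w w') : protAt p K w = protAt p K w' := by
  rw [protAt, protAt, tableAt, tableAt]
  congr 2
  · cases hs : K.sel
    · rfl
    · rw [h.1 hs]
  · congr 2
    · apply cryptsAt_congr
      · intro k hk; rw [h.1 (hK.sel k hk)]
      · intro k hk; rw [h.2 _ (hK.flip₁ k hk)]
      · intro k hk; rw [h.2 _ (hK.flip₂ k hk)]
    · rw [coinsAt, coinsAt]
      congr 1
      funext k
      cases hk : K.flip k
      · rfl
      · rw [h.2 k hk]

end DiningCryptographers

/-! ### Transitions of the whole protocol -/

namespace DiningCryptographers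

open CCSSigma Function

variable {κ : Cmd Lab} {α : Act Chan} {μ : PMF (Proc Chan Lab)}

theorem reached_update (t : ℕ) (n : Fin 3 → ℕ) (k : Fin 3) (m : ℕ) :
    reached t (update n k m) = update (reached t n) k (decide (t ≤ m)) := by
  funext j
  by_cases h : j = k
  · subst h; simp [reached]
  · simp [reached, h]

theorem reachedPred_update (t : ℕ) (n : Fin 3 → ℕ) (k : Fin 3) (m : ℕ) :
    reachedPred t (update n k m) = update (reachedPred t n) (k + 1) (decide (t ≤ m)) := by
  funext j
  by_cases h : j = k + 1
  · subst h; simp [reachedPred]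
  · have : j - 1 ≠ k := fun h' => h (by rw [← h', sub_add_cancel])
    simp [reachedPred, h, this]

theorem update_eq_of_eq {β : Type*} {f : Fin 3 → β} {k : Fin 3} {b : β} (h : f k = b) :
    update f k b = f := by
  rw [← h, update_eq_self]

/-- The distribution of the process after a move. -/
noncomputable def Move.target (p : PMF (Fin 3)) (K : Progress) (w : Outcome) (m : Move) :
    PMF (Proc Chan Lab) :=
  (m.resample p w).map (protAt p (K.next m))

section target

variable {p : PMF (Fin 3)} {K : Progress} {w : Outcome} {k : Fin 3}

/-- This and the next lemmas bring `Move.target` into the form produced by the component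
transitions. Here no cryptographer has been informed yet, so the table does not depend on the payer.
-/
theorem target_select (hK : K.Valid) (h : K.sel = false) :
    Move.select.target p K w = (p.map masterBranch).map fun P => .resAll mChans (.par P
      (tableAt K.stage (fun k => w.1 == k) (fun k => w.2 k == 1) (fun k => w.2 (k + 1) == 1)
        K.flip (reached 2 K.stage) (reachedPred 3 K.stage) w.2)) := by
  have h₀ (k : Fin 3) : K.stage k = 0 := by
    by_contra h'
    simp [hK.sel k (by omega)] at h
  rw [Move.target, Move.resample, PMF.map_comp, PMF.map_comp]
  congr 1
  funext i
  simp only [comp_apply, protAt, Progress.next, tableAt]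
  congr 2
  · simp [masterAt, masterBranch, reached, h₀, Proc.sendBitUnless]
  · congr 2
    exact cryptsAt_congr (fun k hk => by simp [h₀] at hk) (fun _ _ => rfl) (fun _ _ => rfl)

/-- Neither cryptographer served by an unflipped coin has read it, so its sent flags are already
false and its old value occurs nowhere in the table. -/
theorem target_flip (hK : K.Valid) (h : K.flip k = false) :
    (Move.flip k).target p K w = ((PMF.uniformOfFintype (Fin 2)).map fun x =>
      tableAt K.stage (fun k => w.1 == k) (fun k => w.2 k == 1) (fun k => w.2 (k + 1) == 1)
        (update K.flip k true) (update (reached 2 K.stage) k false)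
        (update (reachedPred 3 K.stage) k false) (update w.2 k x)).map
      fun P => .resAll mChans (.par (masterAt p K.sel (reached 1 K.stage) w.1) P) := by
  have h₁ : ¬ 2 ≤ K.stage k := fun h' => by simp [hK.flip₁ k h'] at h
  have h₂ : ¬ 3 ≤ K.stage (k - 1) := fun h' => by
    have := hK.flip₂ _ h'
    simp [h] at this
  rw [Move.target, Move.resample, PMF.map_comp, PMF.map_comp]
  congr 1
  funext x
  simp only [comp_apply, protAt, Progress.next, tableAt]
  rw [update_eq_of_eq (f := reached 2 K.stage) (by simpa [reached] using h₁),
    update_eq_of_eq (f := reachedPred 3 K.stage) (by simpa [reachedPred] using h₂)]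
  congr 4
  refine cryptsAt_congr (fun _ _ => rfl) (fun j hj => ?_) (fun j hj => ?_)
  · rw [update_of_ne]
    rintro rfl
    exact h₁ hj
  · rw [update_of_ne]
    rintro rfl
    exact h₂ (by simpa using hj)

theorem target_inform (h : K.sel = true ∧ K.stage k = 0) :
    (Move.inform k).target p K w = PMF.pure (.resAll mChans (.par
      (masterAt p true (update (reached 1 K.stage) k true) w.1)
      (tableAt (update K.stage k 1) (update (fun k => w.1 == k) k (w.1 == k)) (fun k => w.2 k == 1)
        (fun k => w.2 (k + 1) == 1) K.flip (reached 2 K.stage)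
        (reachedPred 3 K.stage) w.2))) := by
  rw [Move.target, Move.resample, PMF.pure_map, protAt]
  simp only [Progress.next, reached_update, reachedPred_update]
  rw [update_eq_of_eq (f := reached 2 K.stage) (by simp [reached, h.2]),
    update_eq_of_eq (f := reachedPred 3 K.stage) (by simp [reachedPred, h.2]),
    update_eq_of_eq (f := fun k => w.1 == k) rfl, h.1]
  rfl

theorem target_recv₁ (h : K.stage k = 1) :
    (Move.recv₁ k).target p K w = PMF.pure (.resAll mChans (.par
      (masterAt p K.sel (reached 1 K.stage) w.1)
      (tableAt (update K.stage k 2) (fun k => w.1 == k)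
        (update (fun k => w.2 k == 1) k (w.2 k == 1)) (fun k => w.2 (k + 1) == 1) K.flip
        (update (reached 2 K.stage) k true)
        (reachedPred 3 K.stage) w.2))) := by
  rw [Move.target, Move.resample, PMF.pure_map, protAt]
  simp only [Progress.next, reached_update, reachedPred_update]
  rw [update_eq_of_eq (f := reached 1 K.stage) (by simp [reached, h]),
    update_eq_of_eq (f := reachedPred 3 K.stage) (by simp [reachedPred, h]),
    update_eq_of_eq (f := fun k => w.2 k == 1) rfl]
  rfl

theorem target_recv₂ (h : K.stage k = 2) :
    (Move.recv₂ k).target p K w = PMF.pure (.resAll mChans (.par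
      (masterAt p K.sel (reached 1 K.stage) w.1)
      (tableAt (update K.stage k 3) (fun k => w.1 == k) (fun k => w.2 k == 1)
        (update (fun k => w.2 (k + 1) == 1) k (w.2 (k + 1) == 1)) K.flip
        (reached 2 K.stage)
        (update (reachedPred 3 K.stage) (k + 1) true) w.2))) := by
  rw [Move.target, Move.resample, PMF.pure_map, protAt]
  simp only [Progress.next, reached_update, reachedPred_update]
  rw [update_eq_of_eq (f := reached 1 K.stage) (by simp [reached, h]),
    update_eq_of_eq (f := reached 2 K.stage) (by simp [reached, h]),
    update_eq_of_eq (f := fun k => w.2 (k + 1) == 1) rfl]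
  rfl

theorem target_announce (h : K.stage k = 3) :
    (Move.announce k).target p K w = PMF.pure (.resAll mChans (.par
      (masterAt p K.sel (reached 1 K.stage) w.1)
      (tableAt (update K.stage k 4) (fun k => w.1 == k) (fun k => w.2 k == 1)
        (fun k => w.2 (k + 1) == 1) K.flip (reached 2 K.stage)
        (reachedPred 3 K.stage) w.2))) := by
  rw [Move.target, Move.resample, PMF.pure_map, protAt]
  simp only [Progress.next, reached_update, reachedPred_update]
  rw [update_eq_of_eq (f := reached 1 K.stage) (by simp [reached, h]),
    update_eq_of_eq (f := reached 2 K.stage) (by simp [reached, h]),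
    update_eq_of_eq (f := reachedPred 3 K.stage) (by simp [reachedPred, h])]

end target

theorem step_protAt_iff {p : PMF (Fin 3)} {K : Progress} (hK : K.Valid) {w : Outcome} :
    Step (protAt p K w) κ α μ ↔
      ∃ m, K.Enabled m ∧ κ = m.cmd ∧ α = m.act w ∧ μ = m.target p K w := by
  rw [protAt, step_resAll_iff]
  constructor
  · rintro ⟨ν, hs, hα, rfl⟩
    rcases step_par_iff.1 hs with ⟨ν, hν, rfl⟩ | ⟨ν, hν, rfl⟩ |
      ⟨l₁, l₂, β, P', Q', hβ, h₁, h₂, rfl, rfl, rfl⟩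
    · obtain ⟨h, rfl, rfl, rfl⟩ | ⟨h, k, h', rfl, rfl, rfl⟩ := step_masterAt_iff.1 hν
      · exact ⟨.select, h, rfl, rfl, by simp only [target_select hK h, PMF.map_comp]; rfl⟩
      · exact ((hα _ (mem_mChans.2 ⟨_, _, rfl⟩)).2 rfl).elim
    · obtain ⟨k, ⟨h, b, rfl, rfl, rfl⟩ | ⟨h, rfl, rfl, rfl⟩ | ⟨h, rfl, rfl, rfl⟩ |
        ⟨h, h', h'', rfl, rfl, rfl⟩ | ⟨h, h', h'', rfl, rfl, rfl⟩⟩ := step_tableAt_iff.1 hν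
      · exact ((hα _ (mem_mChans.2 ⟨_, _, rfl⟩)).1 rfl).elim
      · exact ⟨.announce k, h, rfl, rfl, by simp only [target_announce h, PMF.pure_map]⟩
      · exact ⟨.flip k, h, rfl, rfl, by simp only [target_flip hK h, PMF.map_comp]; rfl⟩
      · exact ⟨.recv₁ k, ⟨h, h'⟩, rfl, rfl, by simp only [target_recv₁ h, PMF.pure_map]⟩
      · exact ⟨.recv₂ k, ⟨h, h'⟩, rfl, rfl, by simp only [target_recv₂ h, PMF.pure_map]⟩
    · obtain ⟨h, h_κ, rfl, hP⟩ | ⟨h, k, h', h_κ, rfl, hP⟩ := step_masterAt_iff.1 h₁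
      -- The selection of the payer is silent and cannot synchronize.
      · exact (hβ rfl).elim
      obtain ⟨j, ⟨hj, b, h_κ', h_α, hQ⟩ | ⟨hj, h_κ', h_α, hQ⟩ | ⟨hj, h_κ', h_α, hQ⟩ |
        ⟨hj, hj', hj'', h_κ', h_α, hQ⟩ | ⟨hj, hj', hj'', h_κ', h_α, hQ⟩⟩ :=
        step_tableAt_iff.1 h₂ <;>
        simp only [Act.co, Act.inp.injEq, Chan.m.injEq, reduceCtorEq] at h_α
      obtain ⟨rfl, rfl⟩ := h_α
      simp only [Cmd.single.injEq] at h_κ h_κ'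
      subst h_κ h_κ'
      rw [pure_eq_pure] at hP hQ
      subst hP hQ
      exact ⟨.inform k, ⟨h, hj⟩, rfl, rfl, by rw [target_inform ⟨h, hj⟩, PMF.pure_map]⟩
  · rintro ⟨m, h, rfl, rfl, rfl⟩
    match m with
    | .select =>
      exact ⟨_, .par1 _ (step_masterAt_iff.2 (.inl ⟨h, rfl, rfl, rfl⟩)), by simp [Move.act], by
        simp only [target_select hK h, PMF.map_comp]; rfl⟩
    | .flip k =>
      exact ⟨_, .par2 _ (step_tableAt_iff.2 ⟨k, .inr (.inr (.inl ⟨h, rfl, rfl, rfl⟩))⟩),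
        by simp [Move.act], by simp only [target_flip hK h, PMF.map_comp]; rfl⟩
    | .inform k =>
      exact ⟨_, .com (α := .out (.m k (w.1 == k))) (by simp)
        (step_masterAt_iff.2 (.inr ⟨h.1, k, by simp [reached, h.2], rfl, rfl, rfl⟩))
        (step_tableAt_iff.2 ⟨k, .inl ⟨h.2, _, rfl, rfl, rfl⟩⟩), by simp [Move.act], by
        rw [target_inform h, PMF.pure_map]⟩
    | .recv₁ k =>
      exact ⟨_, .par2 _ (step_tableAt_iff.2
        ⟨k, .inr (.inr (.inr (.inl ⟨h.1, h.2, by simp [reached, h.1], rfl, rfl, rfl⟩)))⟩),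
        by simp [Move.act], by simp only [target_recv₁ h.1, PMF.pure_map]⟩
    | .recv₂ k =>
      exact ⟨_, .par2 _ (step_tableAt_iff.2
        ⟨k, .inr (.inr (.inr (.inr ⟨h.1, h.2, by simp [reachedPred, h.1], rfl, rfl, rfl⟩)))⟩),
        by simp [Move.act], by simp only [target_recv₂ h.1, PMF.pure_map]⟩
    | .announce k =>
      refine ⟨_, .par2 _ (step_tableAt_iff.2 ⟨k, .inr (.inl ⟨h, rfl, rfl, rfl⟩)⟩), ?_, by
        simp only [target_announce h, PMF.pure_map]⟩
      intro a ha
      obtain ⟨j, b, rfl⟩ := mem_mChans.1 ha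
      simp [Move.act]

end DiningCryptographers

namespace DiningCryptographers

open CCSSigma Function

/-! ## Scheduled runs of the protocol -/

section Scheduled

variable {X : Type u} {p : PMF (Fin 3)} {K : Progress}

/-- Whether and how a scheduler acts depends only on the progress of the protocol. -/
theorem trans_protAt (hK : K.Valid) (t : SchedTerm Lab X) :
    (∀ w α μ, ¬ t.trans (protAt p K w) α μ) ∨
    ∃ m x, K.Enabled m ∧ ∀ w α μ, t.trans (protAt p K w) α μ ↔
      α = m.act w ∧ μ = (m.resample p w).map fun w' => (protAt p (K.next m) w', x) := by
  induction t with
  | nil => exact .inl fun _ _ _ h => h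
  | cmd κ x =>
    by_cases h : ∃ m, K.Enabled m ∧ κ = m.cmd
    · obtain ⟨m, hm, rfl⟩ := h
      refine .inr ⟨m, x, hm, fun w α μ => ?_⟩
      simp only [SchedTerm.trans, step_protAt_iff hK]
      constructor
      · rintro ⟨ν, ⟨m', hm', h, rfl, rfl⟩, rfl⟩
        obtain rfl := Move.cmd_injective h
        exact ⟨rfl, by rw [Move.target, PMF.map_comp]; rfl⟩
      · rintro ⟨rfl, rfl⟩
        exact ⟨_, ⟨m, hm, rfl, rfl, rfl⟩, by rw [Move.target, PMF.map_comp]; rfl⟩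
    · refine .inl fun w α μ => ?_
      simp only [SchedTerm.trans, step_protAt_iff hK]
      rintro ⟨ν, ⟨m, hm, rfl, -⟩, -⟩
      exact h ⟨m, hm, rfl⟩
  | sum S ih =>
    classical
    -- By induction each summand acts for all outcomes or for none, so the first one that can act is
    -- the same for all outcomes.
    by_cases h : ∃ i, ¬ ∀ w α μ, ¬ (S i).trans (protAt p K w) α μ
    · have hlt : ∀ j < Nat.find h, ∀ w α μ, ¬ (S j).trans (protAt p K w) α μ :=
        fun j hj => not_not.1 (Nat.find_min h hj)
      obtain ⟨m, x, hm, H⟩ := (ih (Nat.find h)).resolve_left (Nat.find_spec h)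
      refine .inr ⟨m, x, hm, fun w α μ => ?_⟩
      rw [← H]
      constructor
      · rintro ⟨i, hi, hi'⟩
        rcases lt_trichotomy i (Nat.find h) with h' | rfl | h'
        · exact (hlt i h' _ _ _ hi).elim
        · exact hi
        · exact (hi' _ h' ⟨_, _, (H w _ _).2 ⟨rfl, rfl⟩⟩).elim
      · exact fun h' => ⟨_, h', fun j hj ⟨β, ν, h''⟩ => hlt j hj _ _ _ h''⟩
    · push Not at h
      exact .inl fun w α μ ⟨i, hi, _⟩ => h i w α μ hi

/-- The moves with the remaining schedulers after them, and the states that are reached for a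
given outcome of the probabilistic choices. -/
noncomputable def trace (p : PMF (Fin 3)) (w : Outcome) :
    Progress → List (Move × X) → List (Act Chan × (Proc Chan Lab × X))
  | _, [] => []
  | K, (m, x) :: r => (m.act w, (protAt p (K.next m) w, x)) :: trace p w (K.next m) r

/-- The moves can be performed one after the other. -/
def Executable : Progress → List (Move × X) → Prop
  | _, [] => True
  | K, (m, _) :: r => K.Enabled m ∧ Executable (K.next m) r

/-- The outcome enters the actions only through the announced bits. -/
theorem map_fst_trace_eq {w w' : Outcome} (h : w.announcement = w'.announcement)
    (K : Progress) (r : List (Move × X)) :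
    (trace p w K r).map Prod.fst = (trace p w' K r).map Prod.fst := by
  induction r generalizing K with
  | nil => rfl
  | cons a r ih =>
    simp only [trace, List.map_cons, ih, List.cons.injEq, and_true]
    cases a.1 <;> simp [Move.act, h]

/-- A message already sent has become `nil`, which is not a prefix; and the three bits sent
determine the payer. -/
theorem masterAt_eq_masterBranch {sel : Bool} {sent : Fin 3 → Bool} {i j : Fin 3}
    (h : masterAt p sel sent i = masterBranch j) : sel = true ∧ i = j := by
  cases sel
  · cases h
  · refine ⟨rfl, ?_⟩
    simp only [masterAt, cond_true, masterBranch, Proc.par3, Proc.par.injEq] at h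
    have hk (k : Fin 3) (h : (Proc.sendBitUnless (sent k) (.lm k) (.m k) (i == k) :
        Proc Chan Lab) = .sendBit (.lm k) (.m k) (j == k)) : (i == k) = (j == k) := by
      cases hs : sent k <;> simp_all [Proc.sendBitUnless, Proc.sendBit]
    obtain ⟨⟨h₀, h₁⟩, h₂⟩ := h
    exact (by decide : ∀ i j : Fin 3, (i == 0) = (j == 0) → (i == 1) = (j == 1) →
      (i == 2) = (j == 2) → i = j) i j (hk 0 h₀) (hk 1 h₁) (hk 2 h₂)

theorem resAll_injective (as : List Chan) :
    Injective (Proc.resAll as : Proc Chan Lab → Proc Chan Lab) := by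
  induction as with
  | nil => exact injective_id
  | cons a as ih =>
    intro P Q h
    exact ih (Proc.res.inj h).2

theorem not_selected_trace (w : Outcome) (i : Fin 3) {r : List (Move × X)} (hs : K.sel = false)
    (hr : ∀ x, (Move.select, x) ∉ r) : trace p w K r ∉ Selected (X := X) i := by
  rintro ⟨s, hs', R, hR⟩
  induction r generalizing K with
  | nil => cases hs'
  | cons a r ih =>
    obtain ⟨m, x⟩ := a
    have hm : m ≠ .select := fun h => hr x (by simp [h])
    have hs : (K.next m).sel = false := by cases m <;> simp_all [Progress.next]
    rcases List.mem_cons.1 hs' with rfl | hs'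
    · have := masterAt_eq_masterBranch (Proc.par.inj (resAll_injective _ hR)).1
      simp [hs] at this
    · exact ih hs (fun x h => hr x (List.mem_cons_of_mem _ h)) hs'

theorem eq_of_selected_trace {w : Outcome} {i : Fin 3} {r : List (Move × X)}
    (h : trace p w K r ∈ Selected (X := X) i) : w.1 = i := by
  obtain ⟨s, hs, R, hR⟩ := h
  induction r generalizing K with
  | nil => cases hs
  | cons a r ih =>
    rcases List.mem_cons.1 hs with rfl | hs
    · exact (masterAt_eq_masterBranch (Proc.par.inj (resAll_injective _ hR)).1).2
    · exact ih hs

/-- Right after the selection nobody has been informed, so the master is literally the chosen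
branch. -/
theorem selected_trace (w : Outcome) {r : List (Move × X)} (hK : K.Valid) (hr : Executable K r)
    {x : X} (hx : (Move.select, x) ∈ r) : trace p w K r ∈ Selected (X := X) w.1 := by
  induction r generalizing K with
  | nil => cases hx
  | cons a r ih =>
    rcases List.mem_cons.1 hx with rfl | hx
    · have h₀ (k : Fin 3) : K.stage k = 0 := by
        by_contra h'
        have h₁ := hK.sel k (by omega)
        have h₂ : K.sel = false := hr.1
        simp [h₁] at h₂
      have hM : masterAt p true (reached 1 K.stage) w.1 = masterBranch w.1 := by
        simp [masterAt, masterBranch, reached, h₀, Proc.sendBitUnless]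
      exact ⟨_, List.mem_cons_self, _, congrArg (fun P => Proc.resAll mChans (.par P _)) hM⟩
    · obtain ⟨s, hs, h⟩ := ih (hK.next hr.1) hr.2 hx
      exact ⟨s, List.mem_cons_of_mem _ hs, h⟩

/-- The complete execution of the protocol with given moves and outcome. -/
noncomputable def run (p : PMF (Fin 3)) (r : List (Move × X)) (w : Outcome) :
    Exec (Proc Chan Lab × X) (Act Chan) :=
  trace p w .start r

theorem run_mem_produces_iff {w w' : Outcome} (h : w.announcement = w'.announcement)
    (r : List (Move × X)) (o : List (Fin 3 × Bool)) :
    run p r w ∈ Produces (X := X) o ↔ run p r w' ∈ Produces (X := X) o := by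
  change ((trace p w .start r).map Prod.fst).filter Act.isVisible = _ ↔
    ((trace p w' .start r).map Prod.fst).filter Act.isVisible = _
  rw [map_fst_trace_eq h]

/-! ### Probabilities -/

/-- The payer is selected with the probabilities `p`, and the coins are fair and independent. -/
noncomputable def outcomes (p : PMF (Fin 3)) : PMF Outcome :=
  p.bind fun i => (PMF.uniformOfFintype (Fin 3 → Fin 2)).map fun v => (i, v)

theorem outcomes_apply (p : PMF (Fin 3)) (i : Fin 3) (v : Fin 3 → Fin 2) :
    outcomes p (i, v) = p i * 8⁻¹ := by
  rw [outcomes, PMF.bind_apply, tsum_eq_single i]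
  · rw [PMF.map_apply, tsum_eq_single v]
    · norm_num [PMF.uniformOfFintype_apply]
    · intro v' hv'
      simp [Ne.symm hv']
  · intro j hj
    simp [PMF.map_apply, Ne.symm hj]

/-- The outcome of a fair coin does not change in distribution when it is flipped again. -/
theorem uniform_bind_update (k : Fin 3) :
    ((PMF.uniformOfFintype (Fin 3 → Fin 2)).bind fun v =>
      (PMF.uniformOfFintype (Fin 2)).map (update v k)) = PMF.uniformOfFintype (Fin 3 → Fin 2) := by
  ext v
  -- The new value must be `v k`, while the old value of coin `k` is free: two pairs, each of weight
  -- 1/8 · 1/2.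
  have hc : (Finset.univ.filter fun x : (Fin 3 → Fin 2) × Fin 2 => v = update x.1 k x.2).card =
      2 := by
    revert v k
    decide
  simp only [PMF.bind_apply, PMF.map_apply, PMF.uniformOfFintype_apply, tsum_fintype]
  rw [← Finset.mul_sum, ← Fintype.sum_prod_type' (f := fun (x : Fin 3 → Fin 2) (b : Fin 2) =>
    if v = update x k b then ((Fintype.card (Fin 2) : ℕ) : ℝ≥0∞)⁻¹ else 0), ← Finset.sum_filter,
    Finset.sum_const, hc, nsmul_eq_mul, Fintype.card_fin,
    ENNReal.mul_inv_cancel (by norm_num) (ENNReal.natCast_ne_top 2), mul_one]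

/-- Payer and coins are independent, so redrawing one of them from its own law changes nothing. This
justifies drawing all choices in advance. -/
theorem outcomes_bind_resample (p : PMF (Fin 3)) (m : Move) :
    ((outcomes p).bind fun w => m.resample p w) = outcomes p := by
  cases m <;> simp only [Move.resample, PMF.bind_pure]
  case select =>
    simp only [outcomes, PMF.bind_bind, PMF.bind_map, comp_def, PMF.bind_const]
    exact PMF.bind_comm _ _ _
  case flip k =>
    simp only [outcomes, PMF.bind_bind, PMF.bind_map, comp_def]
    congr 1
    funext i
    conv_rhs => rw [← uniform_bind_update k, PMF.map_bind]
    simp only [PMF.map_comp, comp_def]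

theorem tsum_outcomes_resample (p : PMF (Fin 3)) (m : Move) (g : Outcome → ℝ≥0∞) :
    ∑' w, outcomes p w * ∑' w', m.resample p w w' * g w' = ∑' w, outcomes p w * g w := by
  conv_rhs => rw [← outcomes_bind_resample p m]
  simp only [PMF.bind_apply, ← ENNReal.tsum_mul_left, ← ENNReal.tsum_mul_right]
  rw [ENNReal.tsum_comm]
  simp only [mul_assoc]

theorem tsum_map_mul {α β : Type*} (q : PMF α) (f : α → β) (g : β → ℝ≥0∞) :
    ∑' b, q.map f b * g b = ∑' a, q a * g (f a) := by
  classical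
  simp only [PMF.map_apply, ← ENNReal.tsum_mul_right]
  rw [ENNReal.tsum_comm]
  refine tsum_congr fun a => ?_
  rw [tsum_eq_single (f a) (fun b hb => by simp [hb])]
  simp

/-- The complete executions of the protocol are those runs of the moves that are chosen by the
scheduler, with a random outcome of the probabilistic choices. -/
theorem exists_trace (p : PMF (Fin 3)) (S : Scheduler.{u} Lab) (hK : K.Valid) (x : S.X) :
    ∃ r : List (Move × S.X), Executable K r ∧
      ∀ f : Outcome → List (Act Chan × (Proc Chan Lab × S.X)) → ℝ≥0∞,
        (∀ w w', K.Agree w w' → f w = f w') →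
        ∑' w, outcomes p w * (completeProcess (prot p) S).expect (protAt p K w, x) (f w) =
          ∑' w, outcomes p w * f w (trace p w K r) := by
  -- The observable `f` has to vary with `w`, because it absorbs the past of the execution;
  -- agreement on the choices made so far is what survives the induction.
  induction h : K.remaining using Nat.strong_induction_on generalizing K x with
  | _ n ih =>
  rcases trans_protAt (p := p) hK (S.eqn x) with H | ⟨m, y, hm, H⟩
  · refine ⟨[], trivial, fun f _ => tsum_congr fun w => ?_⟩
    rw [ProbAut.expect_of_deadlocked (fun α μ => H w α μ)]
    rfl
  · obtain ⟨r, hr, ihr⟩ := ih _ (h ▸ Progress.remaining_next_lt hm) (hK.next hm) y rfl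
    refine ⟨(m, y) :: r, ⟨hm, hr⟩, fun f hf => ?_⟩
    have key := ihr (fun w e => f w ((m.act w, (protAt p (K.next m) w, y)) :: e))
      (fun w w' h => by
        funext e
        rw [hf w w' h.of_next, h.of_next.act_eq hK hm, protAt_congr p (hK.next hm) h])
    refine (tsum_congr fun w => ?_).trans ((tsum_outcomes_resample p m _).trans key)
    have ht : (completeProcess (prot p) S).trans (protAt p K w, x) (m.act w) _ :=
      (H w _ _).2 ⟨rfl, rfl⟩
    rw [ProbAut.expect_of_trans ht fun b ν => (H w b ν).1, tsum_map_mul]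
    congr 1
    refine tsum_congr fun w' => ?_
    -- A redrawn outcome of positive probability agrees with the old one on all earlier choices, so
    -- `f` and the action may be evaluated at either.
    by_cases h₀ : m.resample p w w' = 0
    · simp [h₀]
    · have h := Progress.agree_of_resample hm h₀
      rw [hf w w' h, h.act_eq hK hm]

end Scheduled

/-- For `i ≠ j` the mask inverts the one coin that `i` and `j` share; any two of the three
cryptographers are neighbours. Addition in `Fin 2` is exclusive or. -/
theorem exists_mask (i j : Fin 3) : ∃ c : Fin 3 → Fin 2, ∀ v : Fin 3 → Fin 2,
    Outcome.announcement (i, v) = Outcome.announcement (j, v + c) := by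
  revert i j
  unfold Outcome.announcement
  decide

/-! ### The execution measure and anonymity -/

theorem reachable_protAt {p : PMF (Fin 3)} {S : Scheduler.{u} Lab} {s : Proc Chan Lab × S.X}
    (h : (completeProcess (prot p) S).Reachable s) :
    ∃ K w x, K.Valid ∧ s = (protAt p K w, x) := by
  induction h with
  -- The outcome `(0, 0)` is arbitrary, since nothing has been chosen at the start.
  | init => exact ⟨.start, (0, 0), S.start, Progress.valid_start, rfl⟩
  | step _ ht hμ ih =>
    obtain ⟨K, w, x, hK, rfl⟩ := ih
    rcases trans_protAt (p := p) hK (S.eqn x) with H | ⟨m, y, hm, H⟩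
    · exact (H _ _ _ ht).elim
    · obtain ⟨-, rfl⟩ := (H _ _ _).1 ht
      rw [← PMF.mem_support_iff, PMF.support_map] at hμ
      obtain ⟨w', -, rfl⟩ := hμ
      exact ⟨_, w', y, hK.next hm, rfl⟩

theorem fullyProbabilistic_prot (p : PMF (Fin 3)) (S : Scheduler.{u} Lab) :
    (completeProcess (prot p) S).FullyProbabilistic := by
  intro s hs a b μ ν ha hb
  obtain ⟨K, w, x, hK, rfl⟩ := reachable_protAt hs
  rcases trans_protAt (p := p) hK (S.eqn x) with H | ⟨m, y, hm, H⟩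
  · exact (H _ _ _ ha).elim
  · obtain ⟨rfl, rfl⟩ := (H _ _ _).1 ha
    obtain ⟨rfl, rfl⟩ := (H _ _ _).1 hb
    exact ⟨rfl, rfl⟩

/-- All randomness sits in the outcome: the list of moves is fixed by the scheduler. -/
theorem exists_execMeasure_eq (p : PMF (Fin 3)) (S : Scheduler.{u} Lab) :
    ∃ r : List (Move × S.X), Executable .start r ∧
      ∀ B : Set (Exec (Proc Chan Lab × S.X) (Act Chan)),
        (completeProcess (prot p) S).execMeasure B =
          ∑' w, outcomes p w * B.indicator 1 (run p r w) := by
  obtain ⟨r, hr, h⟩ := exists_trace p S Progress.valid_start S.start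
  refine ⟨r, hr, fun B => ?_⟩
  rw [ProbAut.execMeasure_apply]
  refine Eq.trans ?_ (h (fun _ => B.indicator 1) fun _ _ _ => rfl)
  simp only [protAt_start, ENNReal.tsum_mul_right, PMF.tsum_coe, one_mul]
  rfl

/-- The probability of an event that depends only on the selection and the visible actions. -/
theorem execMeasure_selected_inter (p : PMF (Fin 3)) (S : Scheduler.{u} Lab) :
    ∃ g : Set (Exec (Proc Chan Lab × S.X) (Act Chan)) → Fin 3 → ℝ≥0∞,
      (∀ i B, (completeProcess (prot p) S).execMeasure (Selected i ∩ B) = p i * g B i) ∧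
      (∀ i j o, g (Produces o) i = g (Produces o) j) ∧ ∀ i j, g Set.univ i = g Set.univ j := by
  classical
  obtain ⟨r, hr, h⟩ := exists_execMeasure_eq p S
  -- The weight 1/8 is that of a coin assignment. The case distinction is needed because the
  -- scheduler may never let the master select; whether it does is read off `r` and is independent
  -- of the payer.
  refine ⟨fun B i => ∑' v : Fin 3 → Fin 2, 8⁻¹ *
    if ∃ x, (Move.select, x) ∈ r then B.indicator 1 (run p r (i, v)) else 0, ?_, ?_, ?_⟩
  · intro i B
    rw [h, ENNReal.tsum_prod', tsum_eq_single i]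
    · simp only [outcomes_apply, mul_assoc, ENNReal.tsum_mul_left]
      congr 3
      funext v
      split_ifs with hx
      · obtain ⟨x, hx⟩ := hx
        have := selected_trace (p := p) (i, v) Progress.valid_start hr hx
        simp only [Set.indicator_apply, Set.mem_inter_iff]
        exact if_congr (and_iff_right this) rfl rfl
      · exact Set.indicator_of_notMem (fun h' => not_selected_trace (i, v) i rfl
          (fun x hx' => hx ⟨x, hx'⟩) h'.1) _
    · intro j hj
      refine ENNReal.tsum_eq_zero.2 fun v => ?_
      rw [Set.indicator_of_notMem fun h' => hj (eq_of_selected_trace h'.1), mul_zero]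
  · intro i j o
    obtain ⟨c, hc⟩ := exists_mask i j
    -- Translation by the mask permutes the coin assignments and matches the summands for `i` and
    -- `j`.
    refine Eq.trans (tsum_congr fun v => ?_) ((Equiv.addRight c).tsum_eq _)
    simp only [Equiv.coe_addRight]
    congr 2
    simp only [Set.indicator_apply]
    exact if_congr (run_mem_produces_iff (hc v) r o) rfl rfl
  · intro i j
    simp only [Set.indicator_univ, Pi.one_apply]
end DiningCryptographers

theorem mainTheorem5 (p : PMF (Fin 3)) (S : CCSSigma.Scheduler.{u} DiningCryptographers.Lab) :
    let M := CCSSigma.completeProcess (DiningCryptographers.prot p) S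
    M.FullyProbabilistic ∧
    MeasureTheory.IsProbabilityMeasure M.execMeasure ∧
    ∀ (o : List (Fin 3 × Bool)) (i j : Fin 3),
      M.execMeasure (DiningCryptographers.Selected i) ≠ 0 →
      M.execMeasure (DiningCryptographers.Selected j) ≠ 0 →
      ProbabilityTheory.cond M.execMeasure (DiningCryptographers.Selected i)
          (DiningCryptographers.Produces o) =
        ProbabilityTheory.cond M.execMeasure (DiningCryptographers.Selected j)
          (DiningCryptographers.Produces o) := by
  refine ⟨DiningCryptographers.fullyProbabilistic_prot p S, ⟨?_⟩, fun o i j hi hj => ?_⟩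
  · obtain ⟨r, -, h⟩ := DiningCryptographers.exists_execMeasure_eq p S
    simp only [h, Set.indicator_univ, Pi.one_apply, mul_one, PMF.tsum_coe]
  · obtain ⟨g, hg, hg₁, hg₂⟩ := DiningCryptographers.execMeasure_selected_inter p S
    have hs (i : Fin 3) : (CCSSigma.completeProcess (DiningCryptographers.prot p) S).execMeasure
        (DiningCryptographers.Selected i) = p i * g Set.univ i := by rw [← hg, Set.inter_univ]
    rw [hs] at hi hj
    rw [ProbabilityTheory.cond_apply MeasurableSpace.measurableSet_top,
      ProbabilityTheory.cond_apply MeasurableSpace.measurableSet_top, hg, hg, hs, hs, hg₁ i j,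
      hg₂ i j]
    -- The prior `p i` cancels, being finite and, by the positivity of the selection event, nonzero.
    have key (i : Fin 3) (hi : p i ≠ 0) (x y : ℝ≥0∞) : (p i * x)⁻¹ * (p i * y) = x⁻¹ * y := by
      rw [ENNReal.mul_inv (.inl hi) (.inl (p.apply_ne_top i)), mul_mul_mul_comm,
        ENNReal.inv_mul_cancel hi (p.apply_ne_top i), one_mul]
    rw [key i (left_ne_zero_of_mul hi), key j (left_ne_zero_of_mul hj)]
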